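/- Let $\gamma\in(0,1)$ and $0\le K<\infty$. There is a constant $C=C(\gamma,K)<\infty$ such that the following holds for every dimension $d\ge 1$. Let $\mu$ be a probability measure on $\mathbb{R}^d$ with Lebesgue density $p$, let $Q(x,dy)=q(x,y)\,dy$ be a proposal kernel on $\mathbb{R}^d$, and let $P$ be the Metropolis–Hastings kernel with proposal $Q$ and target $\mu$: a proposed move from $x$ to $y$ is accepted with probability $1\wedge\frac{p(y)q(y,x)}{p(x)q(x,y)}$ (taken to be $1$ if $p(x)q(x,y)=0$), and otherwise the chain stays at $x$. Suppose that $V:\mathbb{R}^d\to[0,\infty)$ satisfies $(PV)(x)\le\gamma V(x)+K$ for all $x\in\mathbb{R}^d$. Let $\Theta\subseteq\mathbb{R}^d$ have $\mu(\Theta)>0$, let $\mu_\Theta(A)=\mu(\Theta\cap A)/\mu(\Theta)$, and let $P_\Theta$ be the Metropolis–Hastings kernel with proposal $Q$ and target density $p_\Theta=p\,\mathbf 1_\Theta/\mu(\Theta)$. Suppose that the mixing time $$\tau=\min\Big\{t\in\mathbb{N}:\ \sup_{x\in\Theta}\|\delta_xP_\Theta^t-\mu_\Theta\|_{TV}<\tfrac14\Big\}$$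 is finite, where $\|\nu-\nu'\|_{TV}=\sup_A|\nu(A)-\nu'(A)|$, and that $$\Theta\supseteq\{x\in\mathbb{R}^d:\ V(x)\le R_2\},\qquad R_2=8\Big(\frac{4K}{(1-\gamma)^2}+\frac{K\tau}{1-\gamma}\Big).$$ Then the relaxation time of $P$ satisfies $t_{rel}(P)\le C\,\tau$. Here $t_{rel}(P)=1/\alpha$ (with $1/0=\infty$), where $\alpha=1-\sup\{|\lambda|:\lambda\in S(P),\ \lambda\neq1\}$ if the eigenvalue $1$ of $P$ on complex $L^2(\mu)$ has multiplicity $1$, and $\alpha=0$ otherwise, and $S(P)$ is the set of nonzero elements of the spectrum of $P$ as an operator on $L^2(\mu)$ (with $\sup\emptyset=0$). -/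

import Mathlib

open MeasureTheory ProbabilityTheory
open scoped ENNReal NNReal

noncomputable section

namespace MHGap

/-! ### Total variation and mixing times -/

section Mixing

variable {X : Type*} [MeasurableSpace X]

/-- Total variation distance `sup_A |ν A - ν' A|` of two probability measures, over measurable `A`. -/
def tvDist (ν ν' : Measure X) : ℝ≥0∞ :=
  ⨆ (A : Set X) (_ : MeasurableSet A), ENNReal.ofReal |ν.real A - ν'.real A|

/-- The mixing time of the kernel `P` (with stationary measure `μ`) on the set `Θ`:
the least `t` with `sup_{x ∈ Θ} ‖δ_x P^t - μ‖_TV < 1/4`, and `⊤` if there is none. -/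
def mixingTime (P : Kernel X X) (μ : Measure X) (Θ : Set X) : ℕ∞ :=
  ⨅ (t : ℕ) (_ : (⨆ x ∈ Θ, tvDist ((P ^ t) x) μ) < 1 / 4), (t : ℕ∞)

end Mixing

/-! ### A Markov kernel as an operator on complex `L²(μ)` -/

section Operator

variable {X : Type*} [MeasurableSpace X] {P : Kernel X X} {μ : Measure X}

theorem ae_ae_of_invariant (h : P.Invariant μ) {s : X → Prop} (hs : ∀ᵐ y ∂μ, s y) :
    ∀ᵐ x ∂μ, ∀ᵐ y ∂(P x), s y := by
  refine Measure.ae_ae_of_ae_bind P.measurable.aemeasurable ?_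
  rw [h.def]; exact hs

theorem lintegral_of_invariant (h : P.Invariant μ) {g : X → ℝ≥0∞} (hg : Measurable g) :
    ∫⁻ x, ∫⁻ y, g y ∂(P x) ∂μ = ∫⁻ y, g y ∂μ := by
  rw [← Measure.lintegral_bind P.measurable.aemeasurable hg.aemeasurable, h.def]

theorem enorm_integral_sq_le [IsMarkovKernel P] (f : Lp ℂ 2 μ) (x : X) :
    ‖∫ y, f y ∂(P x)‖ₑ ^ (2 : ℝ) ≤ ∫⁻ y, ‖f y‖ₑ ^ (2 : ℝ) ∂(P x) := by
  have hm : AEStronglyMeasurable f (P x) := (Lp.stronglyMeasurable f).aestronglyMeasurable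
  have h1 : ‖∫ y, f y ∂(P x)‖ₑ ≤ eLpNorm f 2 (P x) :=
    (enorm_integral_le_lintegral_enorm _).trans
      (eLpNorm_one_eq_lintegral_enorm.symm.le.trans
        (eLpNorm_le_eLpNorm_of_exponent_le (by norm_num) hm))
  calc ‖∫ y, f y ∂(P x)‖ₑ ^ (2 : ℝ) ≤ (eLpNorm f 2 (P x)) ^ (2 : ℝ) := by gcongr
    _ = ∫⁻ y, ‖f y‖ₑ ^ (2 : ℝ) ∂(P x) := by
      rw [eLpNorm_eq_lintegral_rpow_enorm_toReal (by norm_num) (by norm_num), ← ENNReal.rpow_mul]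
      norm_num

theorem stronglyMeasurable_integral (f : Lp ℂ 2 μ) :
    StronglyMeasurable fun x => ∫ y, f y ∂(P x) :=
  (Lp.stronglyMeasurable f).integral_kernel

theorem eLpNorm_integral_le [IsMarkovKernel P] (h : P.Invariant μ) (f : Lp ℂ 2 μ) :
    eLpNorm (fun x => ∫ y, f y ∂(P x)) 2 μ ≤ eLpNorm f 2 μ := by
  rw [eLpNorm_eq_lintegral_rpow_enorm_toReal (by norm_num) (by norm_num),
    eLpNorm_eq_lintegral_rpow_enorm_toReal (by norm_num) (by norm_num)]
  refine ENNReal.rpow_le_rpow ?_ (by norm_num)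
  rw [← lintegral_of_invariant h ((Lp.stronglyMeasurable f).measurable.enorm.pow_const _)]
  exact lintegral_mono fun x => enorm_integral_sq_le f x

theorem memLp_integral [IsMarkovKernel P] (h : P.Invariant μ) (f : Lp ℂ 2 μ) :
    MemLp (fun x => ∫ y, f y ∂(P x)) 2 μ :=
  ⟨(stronglyMeasurable_integral f).aestronglyMeasurable,
    (eLpNorm_integral_le h f).trans_lt (Lp.memLp f).2⟩

theorem ae_integrable [IsMarkovKernel P] (h : P.Invariant μ) (f : Lp ℂ 2 μ) :
    ∀ᵐ x ∂μ, Integrable f (P x) := by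
  have hf := (Lp.memLp f).2
  rw [eLpNorm_lt_top_iff_lintegral_rpow_enorm_lt_top (by norm_num) (by norm_num)] at hf
  have hm : Measurable fun y => ‖f y‖ₑ ^ (2 : ℝ≥0∞).toReal :=
    (Lp.stronglyMeasurable f).measurable.enorm.pow_const _
  rw [← lintegral_of_invariant h hm] at hf
  filter_upwards [ae_lt_top hm.lintegral_kernel hf.ne] with x hx
  refine MemLp.integrable (q := 2) (by norm_num)
    ⟨(Lp.stronglyMeasurable f).aestronglyMeasurable, ?_⟩
  rwa [eLpNorm_lt_top_iff_lintegral_rpow_enorm_lt_top (by norm_num) (by norm_num)]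

/-- The operator `(P f)(x) = ∫ f(y) P(x, dy)` on complex `L²(μ)`, for `μ` invariant under `P`. -/
def markovOp (P : Kernel X X) [IsMarkovKernel P] (μ : Measure X) (h : P.Invariant μ) :
    Lp ℂ 2 μ →L[ℂ] Lp ℂ 2 μ :=
  LinearMap.mkContinuous
    { toFun := fun f => (memLp_integral h f).toLp fun x => ∫ y, f y ∂(P x)
      map_add' := fun f g => by
        rw [← MemLp.toLp_add]
        refine MemLp.toLp_congr _ _ ?_
        filter_upwards [ae_ae_of_invariant h (Lp.coeFn_add f g), ae_integrable h f,
          ae_integrable h g] with x hx hf hg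
        rw [integral_congr_ae hx]
        exact integral_add hf hg
      map_smul' := fun c f => by
        rw [RingHom.id_apply, ← MemLp.toLp_const_smul]
        refine MemLp.toLp_congr _ _ ?_
        filter_upwards [ae_ae_of_invariant h (Lp.coeFn_smul c f)] with x hx
        rw [integral_congr_ae hx]
        exact integral_smul c _ }
    1 fun f => by
      rw [one_mul, LinearMap.coe_mk, AddHom.coe_mk, Lp.norm_toLp, Lp.norm_def]
      exact ENNReal.toReal_mono (Lp.memLp f).2.ne (eLpNorm_integral_le h f)

theorem markovOp_apply_ae [IsMarkovKernel P] (h : P.Invariant μ) (f : Lp ℂ 2 μ) :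
    markovOp P μ h f =ᵐ[μ] fun x => ∫ y, f y ∂(P x) :=
  (memLp_integral h f).coeFn_toLp

/-- The nonzero spectrum `S(P)` of `P` on complex `L²(μ)`. -/
def spectralSet (P : Kernel X X) [IsMarkovKernel P] (μ : Measure X) (h : P.Invariant μ) : Set ℂ :=
  spectrum ℂ (markovOp P μ h) \ {0}

open scoped Classical in
/-- The spectral gap `1 - sup {|z| : z ∈ S(P), z ≠ 1}` (the supremum over the empty set being `0`)
if the eigenvalue `1` has multiplicity one, and `0` otherwise. -/
def spectralGap (P : Kernel X X) [IsMarkovKernel P] (μ : Measure X) (h : P.Invariant μ) : ℝ :=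
  if Module.finrank ℂ (Module.End.eigenspace (markovOp P μ h).toLinearMap 1) = 1 then
    1 - sSup {r : ℝ | ∃ z ∈ spectralSet P μ h, z ≠ 1 ∧ r = ‖z‖}
  else 0

/-- The relaxation time, the inverse of the spectral gap; it is `∞` if the gap is `0`. -/
def relaxationTime (P : Kernel X X) [IsMarkovKernel P] (μ : Measure X) (h : P.Invariant μ) :
    ℝ≥0∞ :=
  (ENNReal.ofReal (spectralGap P μ h))⁻¹

end Operator

/-! ### Metropolis-Hastings kernels -/

section Metropolis

/-- A probability density with respect to the reference measure `volume`. -/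
structure ProbDensity (E : Type*) [MeasureSpace E] where
  /-- the density -/
  toFun : E → ℝ≥0
  measurable : Measurable toFun
  lintegral_eq_one : ∫⁻ x, (toFun x : ℝ≥0∞) = 1

/-- A proposal kernel `Q(x, dy) = q(x, y) dy` given by its transition density. -/
structure ProposalDensity (E : Type*) [MeasureSpace E] where
  /-- the transition density -/
  toFun : E → E → ℝ≥0
  measurable : Measurable (Function.uncurry toFun)
  lintegral_eq_one : ∀ x, ∫⁻ y, (toFun x y : ℝ≥0∞) = 1

variable {E : Type*} [MeasureSpace E]

/-- The probability measure with density `p`. -/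
def ProbDensity.measure (p : ProbDensity E) : Measure E :=
  volume.withDensity fun x => (p.toFun x : ℝ≥0∞)

instance (p : ProbDensity E) : IsProbabilityMeasure p.measure :=
  ⟨by rw [ProbDensity.measure, withDensity_apply _ MeasurableSet.univ, Measure.restrict_univ,
    p.lintegral_eq_one]⟩

/-- The restricted density `p_Θ = p 1_Θ / μ(Θ)`. -/
def ProbDensity.restrict (p : ProbDensity E) (Θ : Set E) (hΘ : MeasurableSet Θ)
    (h0 : p.measure Θ ≠ 0) : ProbDensity E where
  toFun := Θ.indicator fun x => p.toFun x / (p.measure Θ).toNNReal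
  measurable := (p.measurable.div_const _).indicator hΘ
  lintegral_eq_one := by
    have hn : (p.measure Θ).toNNReal ≠ 0 :=
      (ENNReal.toNNReal_pos h0 (measure_ne_top _ _)).ne'
    have h1 : ∀ x, ((Θ.indicator (fun x => p.toFun x / (p.measure Θ).toNNReal) x : ℝ≥0) : ℝ≥0∞)
        = (p.measure Θ)⁻¹ * Θ.indicator (fun x => (p.toFun x : ℝ≥0∞)) x := by
      intro x
      by_cases hx : x ∈ Θ
      · simp only [Set.indicator_of_mem hx]
        rw [ENNReal.coe_div hn, ENNReal.coe_toNNReal (measure_ne_top _ _), mul_comm,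
          div_eq_mul_inv]
      · simp [Set.indicator_of_notMem hx]
    simp_rw [h1]
    rw [lintegral_const_mul' _ _ (ENNReal.inv_ne_top.2 h0), lintegral_indicator hΘ,
      ← withDensity_apply _ hΘ]
    exact ENNReal.inv_mul_cancel h0 (measure_ne_top _ _)

/-- The Metropolis-Hastings acceptance probability `1 ∧ p(y) q(y,x) / (p(x) q(x,y))`, with the
usual convention that it is `1` where the denominator vanishes. -/
def acceptance (p : ProbDensity E) (q : ProposalDensity E) (x y : E) : ℝ≥0 :=
  if p.toFun x * q.toFun x y = 0 then 1
  else min 1 (p.toFun y * q.toFun y x / (p.toFun x * q.toFun x y))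

theorem acceptance_le_one (p : ProbDensity E) (q : ProposalDensity E) (x y : E) :
    acceptance p q x y ≤ 1 := by
  unfold acceptance; split_ifs
  · exact le_rfl
  · exact min_le_left _ _

/-- The density `q(x,y) α(x,y)` of accepted moves. -/
def moveDensity (p : ProbDensity E) (q : ProposalDensity E) (x y : E) : ℝ≥0∞ :=
  ((q.toFun x y * acceptance p q x y : ℝ≥0) : ℝ≥0∞)

theorem measurable_moveDensity (p : ProbDensity E) (q : ProposalDensity E) :
    Measurable (Function.uncurry (moveDensity p q)) := by
  have h1 : Measurable fun z : E × E => p.toFun z.1 * q.toFun z.1 z.2 :=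
    (p.measurable.comp measurable_fst).mul q.measurable
  have h2 : Measurable fun z : E × E => p.toFun z.2 * q.toFun z.2 z.1 :=
    h1.comp measurable_swap
  have h3 : Measurable fun z : E × E => acceptance p q z.1 z.2 :=
    Measurable.ite (measurableSet_eq_fun h1 measurable_const) measurable_const
      (measurable_const.min (h2.div h1))
  exact (q.measurable.mul h3).coe_nnreal_ennreal

theorem lintegral_moveDensity_le_one (p : ProbDensity E) (q : ProposalDensity E) (x : E) :
    ∫⁻ y, moveDensity p q x y ≤ 1 := by
  rw [← q.lintegral_eq_one x]
  refine lintegral_mono fun y => ENNReal.coe_le_coe.2 ?_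
  exact mul_le_of_le_one_right bot_le (acceptance_le_one p q x y)

/-- Detailed balance for the accepted moves. -/
theorem density_mul_moveDensity_symm (p : ProbDensity E) (q : ProposalDensity E) (x y : E) :
    (p.toFun x : ℝ≥0∞) * moveDensity p q x y = (p.toFun y : ℝ≥0∞) * moveDensity p q y x := by
  have key : ∀ x y, p.toFun x * (q.toFun x y * acceptance p q x y)
      = min (p.toFun x * q.toFun x y) (p.toFun y * q.toFun y x) := by
    intro x y
    rw [← mul_assoc]
    unfold acceptance
    split_ifs with h
    · simp [h]
    · rw [mul_min_of_nonneg _ _ bot_le, mul_one, mul_div_cancel₀ _ h]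
  simp only [moveDensity]
  rw [← ENNReal.coe_mul, ← ENNReal.coe_mul, key, key, min_comm]

variable [SFinite (volume : Measure E)]

/-- The Metropolis-Hastings kernel with target density `p` and proposal density `q`:
`P(x, A) = ∫_A q(x,y) α(x,y) dy + δ_x(A) (1 - ∫ q(x,y) α(x,y) dy)`. -/
def metropolis (p : ProbDensity E) (q : ProposalDensity E) : Kernel E E where
  toFun x := volume.withDensity (moveDensity p q x)
    + (1 - ∫⁻ y, moveDensity p q x y) • Measure.dirac x
  measurable' := by
    refine Measure.measurable_of_measurable_coe _ fun s hs => ?_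
    have hm := measurable_moveDensity p q
    have h1 : Measurable fun x => ∫⁻ y in s, moveDensity p q x y := hm.lintegral_prod_right
    have h2 : Measurable fun x => ∫⁻ y, moveDensity p q x y := hm.lintegral_prod_right
    simp only [Measure.coe_add, Pi.add_apply, Measure.smul_apply, smul_eq_mul,
      withDensity_apply _ hs, Measure.dirac_apply' _ hs]
    exact h1.add ((measurable_const.sub h2).mul (measurable_const.indicator hs))

theorem metropolis_apply (p : ProbDensity E) (q : ProposalDensity E) (x : E) {s : Set E}
    (hs : MeasurableSet s) :
    metropolis p q x s = (∫⁻ y in s, moveDensity p q x y)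
      + (1 - ∫⁻ y, moveDensity p q x y) * s.indicator 1 x := by
  change (volume.withDensity (moveDensity p q x)
    + (1 - ∫⁻ y, moveDensity p q x y) • Measure.dirac x) s = _
  simp only [Measure.coe_add, Pi.add_apply, Measure.smul_apply, smul_eq_mul,
      withDensity_apply _ hs, Measure.dirac_apply' _ hs]

instance (p : ProbDensity E) (q : ProposalDensity E) : IsMarkovKernel (metropolis p q) :=
  ⟨fun x => ⟨by
    rw [metropolis_apply p q x MeasurableSet.univ, Measure.restrict_univ]
    simp only [Set.indicator_univ, Pi.one_apply, mul_one]
    exact add_tsub_cancel_of_le (lintegral_moveDensity_le_one p q x)⟩⟩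

theorem metropolis_reversible (p : ProbDensity E) (q : ProposalDensity E) :
    (metropolis p q).IsReversible p.measure := by
  have hm := measurable_moveDensity p q
  have hp : Measurable fun x => (p.toFun x : ℝ≥0∞) := p.measurable.coe_nnreal_ennreal
  have main : ∀ A B : Set E, MeasurableSet A → MeasurableSet B →
      ∫⁻ x in A, metropolis p q x B ∂p.measure
        = (∫⁻ x in A, ∫⁻ y in B, (p.toFun x : ℝ≥0∞) * moveDensity p q x y)
          + ∫⁻ x in A ∩ B, (1 - ∫⁻ y, moveDensity p q x y) ∂p.measure := by
    intro A B hA hB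
    have h1 : Measurable fun x => ∫⁻ y in B, moveDensity p q x y := hm.lintegral_prod_right
    simp_rw [metropolis_apply p q _ hB]
    rw [lintegral_add_left h1]
    congr 1
    · rw [ProbDensity.measure, setLIntegral_withDensity_eq_setLIntegral_mul _ hp h1 hA]
      refine lintegral_congr fun x => ?_
      rw [Pi.mul_apply, lintegral_const_mul']
      exact ENNReal.coe_ne_top
    · rw [Set.inter_comm, ← Measure.restrict_restrict hB, ← lintegral_indicator hB]
      refine lintegral_congr fun x => ?_
      by_cases hx : x ∈ B <;> simp [hx]
  intro A B hA hB
  rw [main A B hA hB, main B A hB hA, Set.inter_comm B A]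
  congr 1
  rw [lintegral_lintegral_swap]
  · refine lintegral_congr fun y => lintegral_congr fun x => ?_
    exact density_mul_moveDensity_symm p q x y
  · exact ((hp.comp measurable_fst).mul hm).aemeasurable

/-- The target distribution is invariant under the Metropolis-Hastings kernel. -/
theorem metropolis_invariant (p : ProbDensity E) (q : ProposalDensity E) :
    (metropolis p q).Invariant p.measure :=
  (metropolis_reversible p q).invariant

end Metropolis

end MHGap

end

/-!
Write `P` for the Metropolis-Hastings chain, `P'` for the chain with the restricted target, and
rescale the Lyapunov function to `W = (1 - γ) V / (4 K)`, so that
`P W ≤ γ W + (1 - γ) / 4`. The set `{p ≠ 0}` has full measure and `P` cannot leave it. On its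
intersection with `Θ` the chain `P'` is `P` with the moves out of `Θ` suppressed
(`metropolis_restrict_le`).

* The two chains agree until `P` leaves `Θ`. As `W` is large off `Θ`, it bounds the probability
  of leaving within `τ` steps, by `1 / 8` when started from `{W ≤ 1}`
  (`pow_apply_le_of_comparison`). With the mixing of `P'` this shows that the laws `P ^ τ x` and
  `P ^ τ y` have total variation distance at most `3 / 4` when `W x, W y ≤ 1`.
* This minorization and the drift condition give, as Hairer and Mattingly showed, that `P ^ τ`
  contracts the weighted oscillation `sup (φ x - φ y) / (2 + (W x + W y) / 2)` by the factor
  `α = (9 + γ) / 10`, which does not depend on `τ` (`integral_sub_le_of_drift`). Because `W` is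
  `μ`-integrable, the variance of `P ^ (τ n) 1_B` is at most `3 α ^ n`.
* Let `A` be the operator of `P` minus the projection onto the constants. It is self-adjoint, so
  `n ↦ ‖A ^ (τ n) f‖` is log-convex and decay of the orbit at a rate bounds the first step:
  `‖A ^ τ f‖ ^ 2 ≤ α ‖f‖ ^ 2` on the dense span of the indicators
  (`norm_apply_sq_le_of_pow_le`). Hence a spectral value `z ≠ 1` of `P` satisfies
  `‖z‖ ^ (2 τ) ≤ α`, and Bernoulli's inequality gives a gap of at least `(1 - α) / (2 τ)`.

For `K = 0` the rescaling is not available, but then `V = 0` almost everywhere and `W = 0` serves.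
The constant is `20 / (1 - γ)`.
-/

namespace MHGap

/-! ### Total variation, powers of kernels, and drift conditions -/

section Probability

variable {X : Type*} [MeasurableSpace X]

theorem integral_eq_integral_real_ge (ν : Measure X) [IsProbabilityMeasure ν] {f : X → ℝ}
    (hf : Measurable f) (h0 : ∀ x, 0 ≤ f x) (h1 : ∀ x, f x ≤ 1) :
    ∫ x, f x ∂ν = ∫ t in Set.Ioc (0 : ℝ) 1, ν.real {x | t ≤ f x} := by
  refine Integrable.integral_eq_integral_Ioc_meas_le ?_ (.of_forall h0) (.of_forall h1)
  exact Integrable.of_bound hf.aestronglyMeasurable 1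
    (.of_forall fun x => by rw [Real.norm_of_nonneg (h0 x)]; exact h1 x)

theorem integrableOn_real_ge (ν : Measure X) [IsProbabilityMeasure ν] (f : X → ℝ) :
    IntegrableOn (fun t : ℝ => ν.real {x | t ≤ f x}) (Set.Ioc 0 1) := by
  have hanti : Antitone fun t : ℝ => ν.real {x | t ≤ f x} := fun s t hst =>
    measureReal_mono fun x hx => le_trans hst hx
  exact Integrable.of_bound hanti.measurable.aestronglyMeasurable 1
    (.of_forall fun t => by rw [Real.norm_of_nonneg measureReal_nonneg]; exact measureReal_le_one)

/-- A total variation bound `ε` controls the integrals of functions with values in `[-1, 1]`, with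
the sharp factor `2`; by the layer cake formula. -/
theorem integral_sub_le_of_forall_real_le {ν ν' : Measure X} [IsProbabilityMeasure ν]
    [IsProbabilityMeasure ν'] {ε : ℝ} (h : ∀ A, MeasurableSet A → ν.real A ≤ ν'.real A + ε)
    {ψ : X → ℝ} (hψ : Measurable ψ) (hb : ∀ x, |ψ x| ≤ 1) :
    ∫ x, ψ x ∂ν - ∫ x, ψ x ∂ν' ≤ 2 * ε := by
  set f : X → ℝ := fun x => (ψ x + 1) / 2 with hf_def
  have hf : Measurable f := (hψ.add_const 1).div_const 2
  have h0 : ∀ x, 0 ≤ f x := fun x => by have := neg_le_of_abs_le (hb x); simp only [f]; linarith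
  have h1 : ∀ x, f x ≤ 1 := fun x => by have := le_of_abs_le (hb x); simp only [f]; linarith
  have hψf : ∀ (ρ : Measure X) [IsProbabilityMeasure ρ], ∫ x, ψ x ∂ρ = 2 * ∫ x, f x ∂ρ - 1 := by
    intro ρ _
    have hi : Integrable ψ ρ := Integrable.of_bound hψ.aestronglyMeasurable 1 (.of_forall hb)
    simp only [f]
    rw [integral_div, integral_add hi (integrable_const _)]
    simp only [integral_const, probReal_univ, smul_eq_mul, mul_one]
    ring
  have hle : ∫ x, f x ∂ν ≤ ∫ x, f x ∂ν' + ε := by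
    rw [integral_eq_integral_real_ge ν hf h0 h1, integral_eq_integral_real_ge ν' hf h0 h1]
    calc ∫ t in Set.Ioc (0 : ℝ) 1, ν.real {x | t ≤ f x}
        ≤ ∫ t in Set.Ioc (0 : ℝ) 1, (ν'.real {x | t ≤ f x} + ε) :=
          integral_mono (integrableOn_real_ge ν f)
            ((integrableOn_real_ge ν' f).add (integrable_const _))
            fun t => h _ (measurableSet_le measurable_const hf)
      _ = _ := by
          rw [integral_add (integrableOn_real_ge ν' f) (integrable_const _)]
          simp
  rw [hψf ν, hψf ν']
  linarith

variable {P P' : Kernel X X} {μ : Measure X} {G : Set X}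

theorem isMarkovKernel_pow (P : Kernel X X) [IsMarkovKernel P] (n : ℕ) : IsMarkovKernel (P ^ n) := by
  induction n with
  | zero => rw [pow_zero]; exact inferInstanceAs (IsMarkovKernel Kernel.id)
  | succ n ih => rw [pow_succ]; exact inferInstanceAs (IsMarkovKernel ((P ^ n) ∘ₖ P))

theorem invariant_pow (h : P.Invariant μ) (n : ℕ) : (P ^ n).Invariant μ := by
  induction n with
  | zero =>
    rw [pow_zero]
    change μ.bind (Kernel.id : Kernel X X) = μ
    exact Measure.id_comp
  | succ n ih => rw [pow_succ]; exact Kernel.Invariant.comp ih h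

theorem lintegral_pow_succ (P : Kernel X X) (n : ℕ) (x : X) {g : X → ℝ≥0∞} (hg : Measurable g) :
    ∫⁻ y, g y ∂((P ^ (n + 1)) x) = ∫⁻ y, ∫⁻ z, g z ∂((P ^ n) y) ∂(P x) := by
  rw [pow_succ]; exact Kernel.lintegral_comp (P ^ n) P x hg

theorem ae_mem_pow (hGm : MeasurableSet G) (hG : ∀ x ∈ G, ∀ᵐ y ∂(P x), y ∈ G) (n : ℕ) :
    ∀ x ∈ G, ∀ᵐ y ∂((P ^ n) x), y ∈ G := by
  induction n with
  | zero =>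
    intro x hx
    rw [pow_zero]
    change ∀ᵐ y ∂((Kernel.id : Kernel X X) x), y ∈ G
    rw [Kernel.id_apply]
    exact (ae_dirac_iff hGm).2 hx
  | succ n ih =>
    intro x hx
    rw [pow_succ]
    refine Kernel.ae_comp_of_ae_ae (κ := P) (η := P ^ n) hGm ?_
    filter_upwards [hG x hx] with y hy using ih y hy

/-- The drift condition passes to powers; with the constant written as `(1 - γ) k` it does so with
the same `k`. -/
theorem lintegral_pow_le_of_drift {W : X → ℝ≥0} (hW : Measurable W) {γ k : ℝ≥0}
    (hγ : γ < 1) (hG : ∀ x ∈ G, ∀ᵐ y ∂(P x), y ∈ G) [IsMarkovKernel P]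
    (hd : ∀ x ∈ G, ∫⁻ y, W y ∂(P x) ≤ γ * W x + (1 - γ) * k) (n : ℕ) :
    ∀ x ∈ G, ∫⁻ y, W y ∂((P ^ n) x) ≤ γ ^ n * W x + (1 - γ ^ n) * k := by
  have hm : Measurable fun y => (W y : ℝ≥0∞) := hW.coe_nnreal_ennreal
  induction n with
  | zero =>
    intro x _
    rw [pow_zero]
    change ∫⁻ y, W y ∂((Kernel.id : Kernel X X) x) ≤ _
    rw [Kernel.id_apply, lintegral_dirac' _ hm]
    simp
  | succ n ih =>
    intro x hx
    rw [lintegral_pow_succ P n x hm]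
    have h1 : ∫⁻ y, ∫⁻ z, W z ∂((P ^ n) y) ∂(P x)
        ≤ ∫⁻ y, ((γ : ℝ≥0∞) ^ n * W y + (1 - γ ^ n) * k) ∂(P x) := by
      refine lintegral_mono_ae ?_
      filter_upwards [hG x hx] with y hy using ih y hy
    refine h1.trans ?_
    rw [lintegral_add_left (hm.const_mul _), lintegral_const_mul _ hm, lintegral_const,
      measure_univ, mul_one]
    refine (add_le_add_left (mul_le_mul_right (hd x hx) _) _).trans ?_
    have hn : γ ^ n ≤ 1 := pow_le_one₀ bot_le hγ.le
    have hn1 : γ ^ (n + 1) ≤ 1 := pow_le_one₀ bot_le hγ.le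
    have key : γ ^ n * (γ * W x + (1 - γ) * k) + (1 - γ ^ n) * k
        ≤ γ ^ (n + 1) * W x + (1 - γ ^ (n + 1)) * k := by
      rw [← NNReal.coe_le_coe]
      push_cast [NNReal.coe_sub hn, NNReal.coe_sub hn1, NNReal.coe_sub hγ.le]
      apply le_of_eq; ring
    exact_mod_cast key

theorem pow_succ_apply (P : Kernel X X) (n : ℕ) (x : X) {A : Set X} (hA : MeasurableSet A) :
    (P ^ (n + 1)) x A = ∫⁻ y, (P ^ n) y A ∂(P x) := by
  rw [pow_succ]; exact Kernel.comp_apply' (P ^ n) P x hA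

/-- A Lyapunov function is integrable against the invariant measure. The drift of `P ^ n` is applied
to truncations of `W`, since `∫ W ∂μ` could be infinite a priori. -/
theorem lintegral_le_of_drift {W : X → ℝ≥0} (hW : Measurable W) {γ k : ℝ≥0}
    (hγ : γ < 1) (hG : ∀ x ∈ G, ∀ᵐ y ∂(P x), y ∈ G) [IsMarkovKernel P]
    [IsProbabilityMeasure μ] (hinv : P.Invariant μ) (hμG : ∀ᵐ x ∂μ, x ∈ G)
    (hd : ∀ x ∈ G, ∫⁻ y, W y ∂(P x) ≤ γ * W x + (1 - γ) * k) :
    ∫⁻ x, W x ∂μ ≤ k := by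
  have hm : Measurable fun y => (W y : ℝ≥0∞) := hW.coe_nnreal_ennreal
  have trunc : ∀ M : ℕ, ∫⁻ x, min (W x : ℝ≥0∞) M ∂μ ≤ k := by
    intro M
    have hle : ∀ n : ℕ, ∫⁻ x, min (W x : ℝ≥0∞) M ∂μ
        ≤ ∫⁻ x, min ((γ : ℝ≥0∞) ^ n * W x + k) M ∂μ := by
      intro n
      have := isMarkovKernel_pow P n
      rw [← lintegral_of_invariant (invariant_pow hinv n) (hm.min measurable_const)]
      refine lintegral_mono_ae ?_
      filter_upwards [hμG] with x hx
      refine le_min ?_ ?_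
      · refine (lintegral_mono fun y => min_le_left _ _).trans
          ((lintegral_pow_le_of_drift hW hγ hG hd n x hx).trans ?_)
        gcongr
        exact mul_le_of_le_one_left bot_le tsub_le_self
      · refine (lintegral_mono fun y => min_le_right _ _).trans ?_
        rw [lintegral_const, measure_univ, mul_one]
    have hlim : Filter.Tendsto (fun n : ℕ => ∫⁻ x, min ((γ : ℝ≥0∞) ^ n * W x + k) M ∂μ)
        Filter.atTop (nhds (∫⁻ _, min (k : ℝ≥0∞) M ∂μ)) := by
      refine tendsto_lintegral_of_dominated_convergence (fun _ => (M : ℝ≥0∞))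
        (fun n => ((hm.const_mul _).add_const _).min measurable_const)
        (fun n => .of_forall fun x => min_le_right _ _)
        (by rw [lintegral_const, measure_univ, mul_one]; exact ENNReal.natCast_ne_top M)
        (.of_forall fun x => ?_)
      have h0 : Filter.Tendsto (fun n : ℕ => (γ : ℝ≥0∞) ^ n) Filter.atTop (nhds 0) :=
        ENNReal.tendsto_pow_atTop_nhds_zero_of_lt_one (by exact_mod_cast hγ)
      have h1 : Filter.Tendsto (fun n : ℕ => (γ : ℝ≥0∞) ^ n * W x + k) Filter.atTop
          (nhds (0 * W x + k)) :=
        (ENNReal.Tendsto.mul_const h0 (Or.inr ENNReal.coe_ne_top)).add tendsto_const_nhds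
      rw [zero_mul, zero_add] at h1
      exact h1.min tendsto_const_nhds
    refine (ge_of_tendsto' hlim hle).trans ?_
    rw [lintegral_const, measure_univ, mul_one]
    exact min_le_left _ _
  have hsup : ∀ x, (W x : ℝ≥0∞) = ⨆ M : ℕ, min (W x : ℝ≥0∞) M := by
    intro x
    rw [← inf_iSup_eq, ENNReal.iSup_natCast, inf_top_eq]
  rw [lintegral_congr hsup]
  rw [lintegral_iSup (fun M => hm.min measurable_const)
    (fun a b hab x => min_le_min_left _ (Nat.cast_le.2 hab))]
  exact iSup_le trunc

/-- Comparison of the chain `P` with a chain `P'` that agrees with it inside `Θ` and stays put instead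
of leaving `Θ`. The function `U`, which is at least `1` off `Θ`, bounds the probability of
having left `Θ`. Only this one-sided bound is needed: passing to the complement of `A` gives the
other side. -/
theorem pow_apply_le_of_comparison {U : X → ℝ≥0} (hU : Measurable U) {k : ℝ≥0} {Θ : Set X}
    (hΘ : MeasurableSet Θ) [IsMarkovKernel P] [IsMarkovKernel P']
    (hG : ∀ x ∈ G, ∀ᵐ y ∂(P x), y ∈ G)
    (hd : ∀ x ∈ G, ∫⁻ y, U y ∂(P x) ≤ U x + k) (hU1 : ∀ x ∈ G, x ∉ Θ → 1 ≤ U x)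
    (hc : ∀ x ∈ G, x ∈ Θ → P' x ≤ (P x).restrict Θ + P x Θᶜ • Measure.dirac x)
    {A : Set X} (hA : MeasurableSet A) (t : ℕ) :
    ∀ x ∈ G, (P' ^ t) x A ≤ (P ^ t) x A + U x + t * k := by
  have hm : Measurable fun y => (U y : ℝ≥0∞) := hU.coe_nnreal_ennreal
  induction t with
  | zero => intro x _; simp only [pow_zero]; rw [add_assoc]; exact le_self_add
  | succ t ih =>
    intro x hx
    have := isMarkovKernel_pow P' (t + 1)
    have := isMarkovKernel_pow P' t
    by_cases hxΘ : x ∈ Θ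
    swap
    · calc (P' ^ (t + 1)) x A ≤ 1 := prob_le_one
        _ ≤ U x := by exact_mod_cast hU1 x hx hxΘ
        _ ≤ (P ^ (t + 1)) x A + U x := le_add_self
        _ ≤ _ := le_self_add
    have hmP' : Measurable fun y => (P' ^ t) y A := Kernel.measurable_coe _ hA
    have hmP : Measurable fun y => (P ^ t) y A := Kernel.measurable_coe _ hA
    calc (P' ^ (t + 1)) x A = ∫⁻ y, (P' ^ t) y A ∂(P' x) :=
          pow_succ_apply _ _ _ hA
      _ ≤ ∫⁻ y, (P' ^ t) y A ∂((P x).restrict Θ + P x Θᶜ • Measure.dirac x) :=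
          lintegral_mono' (hc x hx hxΘ) le_rfl
      _ = ∫⁻ y in Θ, (P' ^ t) y A ∂(P x) + P x Θᶜ * (P' ^ t) x A := by
          rw [lintegral_add_measure, lintegral_smul_measure, lintegral_dirac' _ hmP', smul_eq_mul]
      _ ≤ ∫⁻ y in Θ, ((P ^ t) y A + U y + t * k) ∂(P x)
          + ∫⁻ y in Θᶜ, ((P ^ t) y A + U y + t * k) ∂(P x) := by
          refine add_le_add (setLIntegral_mono_ae' hΘ ?_) ?_
          · filter_upwards [hG x hx] with y hy _ using ih y hy
          · calc P x Θᶜ * (P' ^ t) x A ≤ P x Θᶜ := mul_le_of_le_one_right bot_le prob_le_one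
              _ = ∫⁻ _ in Θᶜ, 1 ∂(P x) := by simp
              _ ≤ _ := by
                refine setLIntegral_mono_ae' hΘ.compl ?_
                filter_upwards [hG x hx] with y hy hyΘ
                calc (1 : ℝ≥0∞) ≤ U y := by exact_mod_cast hU1 y hy hyΘ
                  _ ≤ (P ^ t) y A + U y := le_add_self
                  _ ≤ _ := le_self_add
      _ = ∫⁻ y, ((P ^ t) y A + U y + t * k) ∂(P x) := lintegral_add_compl _ hΘ
      _ = ∫⁻ y, (P ^ t) y A ∂(P x) + ∫⁻ y, U y ∂(P x) + t * k := by
          rw [lintegral_add_right _ measurable_const, lintegral_add_left hmP]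
          simp
      _ ≤ ∫⁻ y, (P ^ t) y A ∂(P x) + (U x + k) + t * k := by gcongr; exact hd x hx
      _ = (P ^ (t + 1)) x A + U x + (t + 1 : ℕ) * k := by
          rw [← pow_succ_apply _ _ _ hA]
          push_cast; ring

end Probability

/-! ### Contraction in a weighted oscillation norm -/

section Harris

/-- A function with weighted oscillation at most `c (2 + (W x + W y) / 2)` is within
`c (1 + W x / 2)` of some constant. -/
theorem exists_abs_sub_le {X : Type*} {G : Set X} {W : X → ℝ≥0} {φ : X → ℝ} {M c : ℝ}
    (hb : ∀ x, |φ x| ≤ M) (hφ : ∀ x ∈ G, ∀ y ∈ G, φ x - φ y ≤ c * (2 + (W x + W y) / 2))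
    (hc : 0 ≤ c) (hne : G.Nonempty) : ∃ m, ∀ x ∈ G, |φ x - m| ≤ c * (1 + W x / 2) := by
  have : Nonempty G := hne.to_subtype
  have hbdd : BddAbove (Set.range fun x : G => φ x - c * (1 + W x / 2)) := by
    refine ⟨M, ?_⟩
    rintro _ ⟨x, rfl⟩
    have h1 := le_of_abs_le (hb x)
    have h2 : 0 ≤ c * (1 + (W x : ℝ) / 2) := by positivity
    dsimp only
    linarith
  refine ⟨⨆ x : G, (φ x - c * (1 + W x / 2)), fun x hx => abs_le.2 ⟨?_, ?_⟩⟩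
  · have : ⨆ x : G, (φ x - c * (1 + W x / 2)) ≤ φ x + c * (1 + W x / 2) := by
      refine ciSup_le fun y => ?_
      have := hφ y y.2 x hx
      linarith
    linarith
  · have := le_ciSup hbdd ⟨x, hx⟩
    dsimp only at this
    linarith

variable {X : Type*} [MeasurableSpace X] {T : Kernel X X} {μ : Measure X} {G : Set X}
  {W : X → ℝ≥0}

theorem integrable_coe_of_lintegral_le {ν : Measure X} (hW : Measurable W) {k : ℝ≥0}
    (h : ∫⁻ y, W y ∂ν ≤ k) : Integrable (fun y => (W y : ℝ)) ν :=
  ⟨(measurable_coe_nnreal_real.comp hW).aestronglyMeasurable, by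
    rw [hasFiniteIntegral_iff_enorm]
    simpa [enorm_eq_nnnorm] using h.trans_lt ENNReal.coe_lt_top⟩

theorem integral_coe_le_of_lintegral_le {ν : Measure X} (hW : Measurable W) {k : ℝ≥0}
    (h : ∫⁻ y, W y ∂ν ≤ k) : ∫ y, (W y : ℝ) ∂ν ≤ k := by
  rw [integral_eq_lintegral_of_nonneg_ae (f := fun y => (W y : ℝ)) (.of_forall fun y => (W y).2)
    (measurable_coe_nnreal_real.comp hW).aestronglyMeasurable]
  refine ENNReal.toReal_le_coe_of_le_coe ?_
  simpa using h

/-- One step of the Harris theorem of Hairer and Mattingly: a drift condition for `W` and a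
minorization on `{W ≤ 1}` make the weighted oscillation contract. -/
theorem integral_sub_le_of_drift [IsMarkovKernel T] (hW : Measurable W)
    (hT : ∀ x ∈ G, ∀ᵐ y ∂(T x), y ∈ G) {a γ : ℝ≥0} (haγ : a ≤ γ) (hγ : γ < 1)
    (hd : ∀ x ∈ G, ∫⁻ y, W y ∂(T x) ≤ a * W x + (1 - a) * (1 / 4 : ℝ≥0))
    (hloc : ∀ x ∈ G, ∀ y ∈ G, W x ≤ 1 → W y ≤ 1 → ∀ A, MeasurableSet A →
      (T x).real A ≤ (T y).real A + 3 / 4)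
    {φ : X → ℝ} (hφm : Measurable φ) {M c : ℝ} (hb : ∀ x, |φ x| ≤ M) (hc : 0 ≤ c)
    (hφ : ∀ x ∈ G, ∀ y ∈ G, φ x - φ y ≤ c * (2 + (W x + W y) / 2)) :
    ∀ x ∈ G, ∀ y ∈ G, ∫ z, φ z ∂(T x) - ∫ z, φ z ∂(T y)
      ≤ (9 + γ) / 10 * c * (2 + (W x + W y) / 2) := by
  intro x hx y hy
  obtain ⟨m, hm⟩ := exists_abs_sub_le hb hφ hc ⟨x, hx⟩
  have ha1 : a ≤ 1 := haγ.trans hγ.le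
  have haγ' : (a : ℝ) ≤ γ := haγ
  have hγ' : (γ : ℝ) < 1 := hγ
  have ha0 : (0 : ℝ) ≤ a := a.2
  have hd' : ∀ x ∈ G, ∫⁻ y, W y ∂(T x) ≤ ((a * W x + (1 - a) * (1 / 4) : ℝ≥0) : ℝ≥0∞) := by
    intro x hx; exact_mod_cast hd x hx
  have hWi : ∀ x ∈ G, Integrable (fun y => (W y : ℝ)) (T x) := fun x hx =>
    integrable_coe_of_lintegral_le hW (hd' x hx)
  have hWle : ∀ x ∈ G, ∫ y, (W y : ℝ) ∂(T x) ≤ a * W x + (1 - a) / 4 := by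
    intro x hx
    have := integral_coe_le_of_lintegral_le hW (hd' x hx)
    push_cast [NNReal.coe_sub ha1] at this
    linarith
  have hφi : ∀ x, Integrable φ (T x) := fun x =>
    Integrable.of_bound hφm.aestronglyMeasurable M (.of_forall hb)
  rcases le_total 1 ((W x : ℝ) + W y) with hS | hS
  · -- Far out, the drift alone gives the contraction.
    have h1 : ∀ x ∈ G, |∫ z, φ z ∂(T x) - m| ≤ c * (1 + (a * W x + (1 - a) / 4) / 2) := by
      intro x hx
      have e : ∫ z, φ z ∂(T x) - m = ∫ z, (φ z - m) ∂(T x) := by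
        rw [integral_sub (hφi x) (integrable_const _)]; simp
      rw [e]
      calc |∫ z, (φ z - m) ∂(T x)| ≤ ∫ z, |φ z - m| ∂(T x) := abs_integral_le_integral_abs
        _ ≤ ∫ z, c * (1 + (W z : ℝ) / 2) ∂(T x) := by
            refine integral_mono_ae ((hφi x).sub (integrable_const _)).abs
              (((integrable_const _).add ((hWi x hx).div_const _)).const_mul _) ?_
            filter_upwards [hT x hx] with z hz using hm z hz
        _ = c * (1 + (∫ z, (W z : ℝ) ∂(T x)) / 2) := by
            rw [integral_const_mul, integral_add (integrable_const _) ((hWi x hx).div_const _),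
              integral_div]
            simp
        _ ≤ _ := by gcongr; exact hWle x hx
    have h2 := le_of_abs_le (h1 x hx)
    have h3 := neg_le_of_abs_le (h1 y hy)
    have h4 : 2 + (a * ((W x : ℝ) + W y) + (1 - a) / 2) / 2
        ≤ (9 + γ) / 10 * (2 + ((W x : ℝ) + W y) / 2) := by
      nlinarith [mul_nonneg (sub_nonneg.2 haγ') (sub_nonneg.2 hS),
        mul_nonneg (sub_nonneg.2 hγ'.le) (sub_nonneg.2 hS)]
    have h5 := mul_le_mul_of_nonneg_left h4 hc
    linarith
  · -- Near the centre, split `φ - m` into a part bounded by `c` and a part bounded by `c W / 2`.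
    rcases hc.eq_or_lt with rfl | hc'
    · have hz : ∀ x ∈ G, ∫ z, φ z ∂(T x) = m := by
        intro x hx
        have : φ =ᵐ[T x] fun _ => m := by
          filter_upwards [hT x hx] with z hz
          have := hm z hz
          rw [zero_mul] at this
          exact sub_eq_zero.1 (abs_nonpos_iff.1 this)
        rw [integral_congr_ae this]; simp
      rw [hz x hx, hz y hy]; simp
    have hWx : W x ≤ 1 := by
      rw [← NNReal.coe_le_coe, NNReal.coe_one]; linarith [(W y).2]
    have hWy : W y ≤ 1 := by
      rw [← NNReal.coe_le_coe, NNReal.coe_one]; linarith [(W x).2]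
    set ψ : X → ℝ := fun z => max (-1) (min 1 ((φ z - m) / c))
    have hψm : Measurable ψ :=
      measurable_const.max (measurable_const.min ((hφm.sub_const _).div_const _))
    have hψb : ∀ z, |ψ z| ≤ 1 := fun z =>
      abs_le.2 ⟨le_max_left _ _, max_le (by norm_num) (min_le_left _ _)⟩
    have hψi : ∀ x, Integrable ψ (T x) := fun x =>
      Integrable.of_bound hψm.aestronglyMeasurable 1 (.of_forall hψb)
    have hrem : ∀ z ∈ G, |φ z - m - c * ψ z| ≤ c * ((W z : ℝ) / 2) := by
      intro z hz
      have h1 := hm z hz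
      have hw : (0 : ℝ) ≤ W z := (W z).2
      have hu : φ z - m = c * ((φ z - m) / c) := by field_simp
      set u := (φ z - m) / c
      have h2 : |u| ≤ 1 + W z / 2 := by
        rw [hu, abs_mul, abs_of_pos hc'] at h1
        exact le_of_mul_le_mul_left h1 hc'
      have h3 : |u - max (-1) (min 1 u)| ≤ W z / 2 := by
        have := abs_le.1 h2
        refine abs_le.2 ⟨?_, ?_⟩
        · rcases le_total u (-1) with h | h
          · rw [min_eq_right (by linarith), max_eq_left h]; linarith
          · linarith [max_le h (min_le_right 1 u)]
        · have : u - W z / 2 ≤ min 1 u := le_min (by linarith) (by linarith)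
          linarith [le_max_right (-1) (min 1 u)]
      have e : φ z - m - c * ψ z = c * (u - max (-1) (min 1 u)) := by
        rw [mul_sub, ← hu]
      rw [e, abs_mul, abs_of_pos hc']
      gcongr
    have h1 : ∀ x ∈ G, |∫ z, φ z ∂(T x) - m - c * ∫ z, ψ z ∂(T x)|
        ≤ c * ((a * W x + (1 - a) / 4) / 2) := by
      intro x hx
      have e : ∫ z, φ z ∂(T x) - m - c * ∫ z, ψ z ∂(T x) = ∫ z, (φ z - m - c * ψ z) ∂(T x) := by
        have hi : Integrable (fun z => φ z - m) (T x) := (hφi x).sub (integrable_const _)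
        rw [integral_sub hi ((hψi x).const_mul _),
          integral_sub (hφi x) (integrable_const _), integral_const_mul]
        simp
      rw [e]
      calc |∫ z, (φ z - m - c * ψ z) ∂(T x)| ≤ ∫ z, |φ z - m - c * ψ z| ∂(T x) :=
            abs_integral_le_integral_abs
        _ ≤ ∫ z, c * ((W z : ℝ) / 2) ∂(T x) := by
            refine integral_mono_ae
              (((hφi x).sub (integrable_const _)).sub ((hψi x).const_mul _)).abs
              (((hWi x hx).div_const _).const_mul _) ?_
            filter_upwards [hT x hx] with z hz using hrem z hz
        _ = c * ((∫ z, (W z : ℝ) ∂(T x)) / 2) := by rw [integral_const_mul, integral_div]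
        _ ≤ _ := by gcongr; exact hWle x hx
    have h2 := le_of_abs_le (h1 x hx)
    have h3 := neg_le_of_abs_le (h1 y hy)
    have h4 : c * (∫ z, ψ z ∂(T x) - ∫ z, ψ z ∂(T y)) ≤ c * (2 * (3 / 4)) :=
      mul_le_mul_of_nonneg_left (integral_sub_le_of_forall_real_le
        (hloc x hx y hy hWx hWy) hψm hψb) hc
    have h5 : 3 / 2 + (a * ((W x : ℝ) + W y) + (1 - a) / 2) / 2
        ≤ (9 + γ) / 10 * (2 + ((W x : ℝ) + W y) / 2) := by
      have hS0 : 0 ≤ (W x : ℝ) + W y := by positivity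
      nlinarith [mul_nonneg (sub_nonneg.2 haγ') hS0, mul_nonneg (sub_nonneg.2 hγ'.le) hS0]
    have h6 := mul_le_mul_of_nonneg_left h5 hc
    linarith

theorem integral_real_eq_pow_succ [IsMarkovKernel T] (n : ℕ) (x : X) {B : Set X}
    (hB : MeasurableSet B) : ((T ^ (n + 1)) x).real B = ∫ y, ((T ^ n) y).real B ∂(T x) := by
  have := isMarkovKernel_pow T n
  rw [integral_eq_lintegral_of_nonneg_ae (.of_forall fun y => measureReal_nonneg)
    (Kernel.measurable_coe _ hB).ennreal_toReal.aestronglyMeasurable, Measure.real,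
    pow_succ_apply T n x hB]
  simp

/-- Iterating the contraction: the law of the chain forgets its starting point geometrically. -/
theorem real_pow_sub_le_of_drift [IsMarkovKernel T] (hW : Measurable W)
    (hT : ∀ x ∈ G, ∀ᵐ y ∂(T x), y ∈ G) {a γ : ℝ≥0} (haγ : a ≤ γ) (hγ : γ < 1)
    (hd : ∀ x ∈ G, ∫⁻ y, W y ∂(T x) ≤ a * W x + (1 - a) * (1 / 4 : ℝ≥0))
    (hloc : ∀ x ∈ G, ∀ y ∈ G, W x ≤ 1 → W y ≤ 1 → ∀ A, MeasurableSet A →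
      (T x).real A ≤ (T y).real A + 3 / 4)
    {B : Set X} (hB : MeasurableSet B) (n : ℕ) :
    ∀ x ∈ G, ∀ y ∈ G, ((T ^ n) x).real B - ((T ^ n) y).real B
      ≤ ((9 + γ) / 10) ^ n * (2 + (W x + W y) / 2) := by
  induction n with
  | zero =>
    intro x _ y _
    have := isMarkovKernel_pow T 0
    have h1 : ((T ^ 0) x).real B ≤ 1 := measureReal_le_one
    have h2 : 0 ≤ ((T ^ 0) y).real B := measureReal_nonneg
    have h3 := (W x).2
    have h4 := (W y).2
    rw [pow_zero ((9 + (γ : ℝ)) / 10)]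
    simp only [NNReal.val_eq_coe] at h3 h4
    linarith
  | succ n ih =>
    intro x hx y hy
    have := isMarkovKernel_pow T n
    rw [integral_real_eq_pow_succ n x hB, integral_real_eq_pow_succ n y hB, pow_succ']
    exact integral_sub_le_of_drift hW hT haγ hγ hd hloc
      (Kernel.measurable_coe _ hB).ennreal_toReal (M := 1)
      (fun x => by
        rw [← Measure.real, abs_of_nonneg measureReal_nonneg]; exact measureReal_le_one)
      (by positivity) ih x hx y hy

/-- Geometric ergodicity, averaged over the invariant measure. -/
theorem integral_sq_real_pow_sub_le_of_drift [IsMarkovKernel T] [IsProbabilityMeasure μ]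
    (hinv : T.Invariant μ) (hμG : ∀ᵐ x ∂μ, x ∈ G) (hW : Measurable W)
    (hT : ∀ x ∈ G, ∀ᵐ y ∂(T x), y ∈ G) {a γ : ℝ≥0} (haγ : a ≤ γ) (hγ : γ < 1)
    (hd : ∀ x ∈ G, ∫⁻ y, W y ∂(T x) ≤ a * W x + (1 - a) * (1 / 4 : ℝ≥0))
    (hloc : ∀ x ∈ G, ∀ y ∈ G, W x ≤ 1 → W y ≤ 1 → ∀ A, MeasurableSet A →
      (T x).real A ≤ (T y).real A + 3 / 4)
    {B : Set X} (hB : MeasurableSet B) (n : ℕ) :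
    ∫ x, (((T ^ n) x).real B - μ.real B) ^ 2 ∂μ ≤ 3 * ((9 + γ) / 10 : ℝ) ^ n := by
  have hWint : ∫⁻ x, W x ∂μ ≤ (1 / 4 : ℝ≥0) :=
    lintegral_le_of_drift hW (haγ.trans_lt hγ) hT hinv hμG hd
  have hWi := integrable_coe_of_lintegral_le hW hWint
  have hWle := integral_coe_le_of_lintegral_le hW hWint
  have := isMarkovKernel_pow T n
  set f : X → ℝ := fun x => ((T ^ n) x).real B
  have hfm : Measurable f := (Kernel.measurable_coe _ hB).ennreal_toReal
  have hf0 : ∀ x, 0 ≤ f x := fun x => measureReal_nonneg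
  have hf1 : ∀ x, f x ≤ 1 := fun x => measureReal_le_one
  have hfi : Integrable f μ := Integrable.of_bound hfm.aestronglyMeasurable 1
    (.of_forall fun x => by rw [Real.norm_of_nonneg (hf0 x)]; exact hf1 x)
  have hmean : ∫ x, f x ∂μ = μ.real B := by
    rw [integral_eq_lintegral_of_nonneg_ae (.of_forall hf0) hfm.aestronglyMeasurable,
      Measure.real]
    congr 1
    rw [lintegral_congr fun x => ofReal_measureReal (μ := (T ^ n) x) (s := B),
      ← Measure.bind_apply hB (Kernel.aemeasurable _), (invariant_pow hinv n).def]
  set r : ℝ := ((9 + γ) / 10) ^ n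
  have hr0 : 0 ≤ r := by positivity
  have hosc : ∀ x ∈ G, ∀ y ∈ G, f x - f y ≤ r * (2 + (W x + W y) / 2) :=
    real_pow_sub_le_of_drift hW hT haγ hγ hd hloc hB n
  have hbound : ∀ x ∈ G, |f x - μ.real B| ≤ r * (2 + 1 / 8 + W x / 2) := by
    intro x hx
    have hi : Integrable (fun y => ((W x : ℝ) + W y) / 2) μ :=
      ((integrable_const _).add hWi).div_const _
    have hbi : Integrable (fun y => r * (2 + ((W x : ℝ) + W y) / 2)) μ :=
      ((integrable_const _).add hi).const_mul _
    have hbv : ∫ y, r * (2 + ((W x : ℝ) + W y) / 2) ∂μ ≤ r * (2 + 1 / 8 + W x / 2) := by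
      rw [integral_const_mul, integral_add (integrable_const _) hi, integral_div,
        integral_add (integrable_const _) hWi]
      simp only [integral_const, probReal_univ, smul_eq_mul, one_mul]
      refine mul_le_mul_of_nonneg_left ?_ hr0
      push_cast at hWle
      linarith
    have h1 : ∫ y, (f x - f y) ∂μ = f x - μ.real B := by
      rw [integral_sub (integrable_const _) hfi, hmean]; simp
    rw [← h1]
    refine (abs_integral_le_integral_abs).trans ((integral_mono_ae
      ((integrable_const _).sub hfi).abs hbi ?_).trans hbv)
    filter_upwards [hμG] with y hy
    refine abs_le.2 ⟨?_, hosc x hx y hy⟩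
    change _ ≤ f x - f y
    have := hosc y hy x hx
    rw [add_comm (W y : ℝ)] at this
    linarith
  have hμB0 : 0 ≤ μ.real B := measureReal_nonneg
  have hμB1 : μ.real B ≤ 1 := measureReal_le_one
  calc ∫ x, (f x - μ.real B) ^ 2 ∂μ ≤ ∫ x, r * (2 + 1 / 8 + W x / 2) ∂μ := by
        refine integral_mono_ae ?_
          (((integrable_const _).add (hWi.div_const _)).const_mul _) ?_
        · refine Integrable.of_bound ((hfm.sub_const _).pow_const 2).aestronglyMeasurable 1
            (.of_forall fun x => ?_)
          rw [Real.norm_of_nonneg (sq_nonneg _)]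
          nlinarith [hf0 x, hf1 x]
        · filter_upwards [hμG] with x hx
          refine le_trans ?_ (hbound x hx)
          have : |f x - μ.real B| ≤ 1 := abs_le.2 ⟨by linarith [hf0 x], by linarith [hf1 x]⟩
          rw [← sq_abs]
          nlinarith [abs_nonneg (f x - μ.real B)]
    _ ≤ 3 * r := by
        rw [integral_const_mul, integral_add (integrable_const _) (hWi.div_const _), integral_div]
        simp only [integral_const, probReal_univ, smul_eq_mul, one_mul]
        push_cast at hWle
        nlinarith

end Harris

/-! ### Self-adjoint operators with decaying orbits -/

section Hilbert

variable {E : Type*} [NormedAddCommGroup E] [InnerProductSpace ℂ E] [CompleteSpace E]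

/-- For a self-adjoint operator the sequence `‖B ^ n f‖` is log-convex, so that its first ratio is
bounded by its exponential rate. -/
theorem norm_apply_sq_le_of_pow_le {B : E →L[ℂ] E} (hB : IsSelfAdjoint B) {α C : ℝ} (hα : 0 < α)
    {f : E} (h : ∀ n, 0 < n → ‖(B ^ n) f‖ ^ 2 ≤ C * α ^ n) : ‖B f‖ ^ 2 ≤ α * ‖f‖ ^ 2 := by
  by_contra! hlt
  set s : ℕ → ℝ := fun n => ‖(B ^ n) f‖ with hs
  have hs0 : s 0 = ‖f‖ := by simp [hs]
  have hs1 : s 1 = ‖B f‖ := by simp [hs]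
  have hconv : ∀ n, s (n + 1) ^ 2 ≤ s n * s (n + 2) := by
    intro n
    have h1 : inner ℂ ((B ^ (n + 1)) f) ((B ^ (n + 1)) f)
        = inner ℂ ((B ^ n) f) ((B ^ (n + 2)) f) := by
      rw [pow_succ' B (n + 1), mul_apply_eq_comp]
      nth_rw 1 [pow_succ' B n]
      rw [mul_apply_eq_comp]
      exact hB.isSymmetric _ _
    have h2 : ‖inner ℂ ((B ^ (n + 1)) f) ((B ^ (n + 1)) f)‖ = s (n + 1) ^ 2 := by
      rw [inner_self_eq_norm_sq_to_K]; simp [hs]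
    rw [← h2, h1]
    exact norm_inner_le_norm _ _
  have hfpos : 0 < s 0 := by
    rw [hs0]
    refine norm_pos_iff.2 fun hf => ?_
    simp [hf] at hlt
  -- a ratio `r > α` that stays a lower bound for all later ratios
  set r : ℝ := s 1 ^ 2 / s 0 ^ 2 with hr
  have hrα : α < r := by
    rw [hr, lt_div_iff₀ (by positivity), hs0, hs1]; exact hlt
  have hr0 : 0 < r := hα.trans hrα
  have hgrow : ∀ n, 0 < s n ∧ r * s n ^ 2 ≤ s (n + 1) ^ 2 := by
    intro n
    induction n with
    | zero => exact ⟨hfpos, by rw [hr, div_mul_cancel₀ _ (by positivity)]⟩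
    | succ n ih =>
      obtain ⟨hp, hle⟩ := ih
      have hp1 : 0 < s (n + 1) := by
        refine (norm_nonneg _).lt_of_ne fun h0 => ?_
        have : s (n + 1) = 0 := h0.symm
        rw [this] at hle
        have := mul_pos hr0 (pow_pos hp 2)
        norm_num at hle
        linarith
      refine ⟨hp1, ?_⟩
      have h4 : (s (n + 1) ^ 2) ^ 2 ≤ (s n * s (n + 2)) ^ 2 :=
        pow_le_pow_left₀ (by positivity) (hconv n) 2
      refine le_of_mul_le_mul_left ?_ (pow_pos hp 2)
      calc s n ^ 2 * (r * s (n + 1) ^ 2) = (r * s n ^ 2) * s (n + 1) ^ 2 := by ring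
        _ ≤ s (n + 1) ^ 2 * s (n + 1) ^ 2 := by gcongr
        _ = (s (n + 1) ^ 2) ^ 2 := by ring
        _ ≤ (s n * s (n + 2)) ^ 2 := h4
        _ = s n ^ 2 * s (n + 1 + 1) ^ 2 := by ring
  have hpow : ∀ n, r ^ n * s 0 ^ 2 ≤ s n ^ 2 := by
    intro n
    induction n with
    | zero => simp
    | succ n ih =>
      calc r ^ (n + 1) * s 0 ^ 2 = r * (r ^ n * s 0 ^ 2) := by ring
        _ ≤ r * s n ^ 2 := by gcongr
        _ ≤ _ := (hgrow n).2
  obtain ⟨n, hn⟩ := pow_unbounded_of_one_lt (C / s 0 ^ 2) ((one_lt_div hα).2 hrα)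
  have hn1 : C / s 0 ^ 2 < (r / α) ^ (n + 1) :=
    hn.trans_le (pow_le_pow_right₀ ((one_lt_div hα).2 hrα).le n.le_succ)
  rw [div_pow, div_lt_div_iff₀ (by positivity) (by positivity)] at hn1
  have := h (n + 1) n.succ_pos
  have := hpow (n + 1)
  linarith

/-- The vectors `f` with `‖B ^ n f‖ = O(√α ^ n)`. The case `n = 0` is left out, so that a bound known
only for proper powers applies. -/
def decaySubmodule (B : E →L[ℂ] E) (α : ℝ) : Submodule ℂ E where
  carrier := {f | ∃ C : ℝ, ∀ n, 0 < n → ‖(B ^ n) f‖ ^ 2 ≤ C * α ^ n}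
  zero_mem' := ⟨0, fun n _ => by simp⟩
  add_mem' := by
    rintro f g ⟨C, hC⟩ ⟨C', hC'⟩
    refine ⟨2 * C + 2 * C', fun n hn => ?_⟩
    rw [map_add]
    have h1 := norm_add_le ((B ^ n) f) ((B ^ n) g)
    have h2 := hC n hn
    have h3 := hC' n hn
    nlinarith [sq_nonneg (‖(B ^ n) f‖ - ‖(B ^ n) g‖), norm_nonneg ((B ^ n) f + (B ^ n) g),
      norm_nonneg ((B ^ n) f), norm_nonneg ((B ^ n) g)]
  smul_mem' := by
    rintro c f ⟨C, hC⟩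
    refine ⟨‖c‖ ^ 2 * C, fun n hn => ?_⟩
    rw [map_smul, norm_smul, mul_pow, mul_assoc]
    exact mul_le_mul_of_nonneg_left (hC n hn) (by positivity)

/-- Decay of the orbits on a dense subspace bounds the norm of a self-adjoint operator. -/
theorem opNorm_le_sqrt_of_decaySubmodule {B : E →L[ℂ] E} (hB : IsSelfAdjoint B) {α : ℝ}
    (hα : 0 < α) (hd : (decaySubmodule B α).topologicalClosure = ⊤) : ‖B‖ ≤ √α := by
  refine ContinuousLinearMap.opNorm_le_bound _ (Real.sqrt_nonneg _) fun f => ?_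
  have hcl : IsClosed {f : E | ‖B f‖ ^ 2 ≤ α * ‖f‖ ^ 2} :=
    isClosed_le (by fun_prop) (by fun_prop)
  have hsub : closure (decaySubmodule B α : Set E) ⊆ {f : E | ‖B f‖ ^ 2 ≤ α * ‖f‖ ^ 2} :=
    hcl.closure_subset_iff.2 fun f ⟨C, hC⟩ => norm_apply_sq_le_of_pow_le hB hα hC
  have hf : f ∈ (decaySubmodule B α).topologicalClosure := hd ▸ Submodule.mem_top
  refine abs_le_of_sq_le_sq' ?_ (by positivity) |>.2
  rw [mul_pow, Real.sq_sqrt hα.le]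
  exact hsub hf

/-- The spectrum of `A + p` with `p` idempotent and `A p = 0`, away from `0` and `1`. It rests on the
factorization `(z - A) (z - p) = z (z - (A + p))`. -/
theorem mem_spectrum_of_mem_spectrum_add_idempotent {R : Type*} [Ring R] [Algebra ℂ R] {A p : R}
    (hp : p * p = p) (hAp : A * p = 0) {z : ℂ} (hz : z ∈ spectrum ℂ (A + p)) (h0 : z ≠ 0)
    (h1 : z ≠ 1) : z ∈ spectrum ℂ A := by
  rw [spectrum.mem_iff] at hz ⊢
  intro hA
  apply hz
  have hup : IsUnit (algebraMap ℂ R z - p) := by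
    refine spectrum.notMem_iff.1 fun h => ?_
    rcases IsIdempotentElem.spectrum_subset ℂ hp h with h | h
    exacts [h0 h, h1 h]
  have hmul : (algebraMap ℂ R z - A) * (algebraMap ℂ R z - p)
      = algebraMap ℂ R z * (algebraMap ℂ R z - (A + p)) := by
    rw [sub_mul, mul_sub, mul_sub, hAp, sub_zero, ← Algebra.commutes z A, mul_sub, mul_add]
    abel
  have hu := hA.mul hup
  rw [hmul] at hu
  exact ((IsUnit.mk0 z h0).map (algebraMap ℂ R)).mul_left_iff.1 hu

end Hilbert

/-! ### The Markov operator on `L²(μ)` -/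

section Operator

variable {X : Type*} [MeasurableSpace X] {P : Kernel X X} {μ : Measure X}

/-- The indicator of a measurable set as an element of complex `L²(μ)`. -/
noncomputable abbrev indL2 (μ : Measure X) [IsProbabilityMeasure μ] {B : Set X}
    (hB : MeasurableSet B) : Lp ℂ 2 μ :=
  indicatorConstLp 2 hB (measure_ne_top μ B) 1

theorem norm_sq_eq_integral (f : Lp ℂ 2 μ) : ‖f‖ ^ 2 = ∫ x, ‖f x‖ ^ 2 ∂μ := by
  have h : (inner ℂ f f : ℂ) = ((∫ x, ‖f x‖ ^ 2 ∂μ : ℝ) : ℂ) := by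
    rw [L2.inner_def, ← integral_complex_ofReal]
    refine integral_congr_ae (.of_forall fun x => ?_)
    dsimp only
    rw [inner_self_eq_norm_sq_to_K]
    simp
  rw [inner_self_eq_norm_sq_to_K, ← RCLike.ofReal_pow] at h
  exact Complex.ofReal_injective h

variable [IsProbabilityMeasure μ]

/-- The indicators span a dense subspace of `L²(μ)`. -/
theorem eq_top_of_indL2_mem (S : Submodule ℂ (Lp ℂ 2 μ)) (hS : IsClosed (S : Set (Lp ℂ 2 μ)))
    (h : ∀ (B : Set X) (hB : MeasurableSet B), indL2 μ hB ∈ S) : S = ⊤ := by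
  refine Submodule.eq_top_iff'.2 fun f => ?_
  refine Lp.induction (by norm_num) (motive := fun f => f ∈ S) ?_ ?_ hS f
  · intro c B hB _
    have : (Lp.simpleFunc.indicatorConst 2 hB (measure_ne_top μ B) c : Lp ℂ 2 μ)
        = c • indL2 μ hB := by
      rw [Lp.simpleFunc.coe_indicatorConst, indL2, indicatorConstLp, indicatorConstLp,
        ← MemLp.toLp_const_smul]
      refine MemLp.toLp_congr _ _ (.of_forall fun x => ?_)
      by_cases hx : x ∈ B <;> simp [hx]
    rw [this]
    exact S.smul_mem c (h B hB)
  · intro f g _ _ _ hf hg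
    exact S.add_mem hf hg

variable [IsMarkovKernel P]

theorem markovOp_pow_indL2_ae (h : P.Invariant μ) {B : Set X} (hB : MeasurableSet B) (n : ℕ) :
    (markovOp P μ h ^ n) (indL2 μ hB) =ᵐ[μ] fun x => (((P ^ n) x).real B : ℂ) := by
  induction n with
  | zero =>
    rw [pow_zero, one_apply_eq_self]
    filter_upwards [indicatorConstLp_coeFn (μ := μ) (p := 2) (hs := hB)
      (hμs := measure_ne_top μ B) (c := (1 : ℂ))] with x hx
    rw [hx, pow_zero]
    change _ = (((Kernel.id : Kernel X X) x).real B : ℂ)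
    rw [Kernel.id_apply, Measure.real, Measure.dirac_apply' _ hB]
    by_cases hxB : x ∈ B <;> simp [hxB]
  | succ n ih =>
    rw [pow_succ', mul_apply_eq_comp]
    filter_upwards [markovOp_apply_ae h ((markovOp P μ h ^ n) (indL2 μ hB)),
      ae_ae_of_invariant h ih] with x hx1 hx2
    rw [hx1, integral_congr_ae hx2, integral_complex_ofReal, integral_real_eq_pow_succ n x hB]

theorem inner_indL2_markovOp_indL2 (h : P.Invariant μ) {A B : Set X} (hA : MeasurableSet A)
    (hB : MeasurableSet B) :
    inner ℂ (indL2 μ hA) (markovOp P μ h (indL2 μ hB))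
      = (((∫⁻ x in A, P x B ∂μ).toReal : ℝ) : ℂ) := by
  rw [L2.inner_indicatorConstLp_one]
  have h1 : markovOp P μ h (indL2 μ hB) =ᵐ[μ] fun x => ((P x).real B : ℂ) := by
    simpa using markovOp_pow_indL2_ae h hB 1
  rw [integral_congr_ae (ae_restrict_of_ae h1), integral_complex_ofReal,
    integral_eq_lintegral_of_nonneg_ae (.of_forall fun y => measureReal_nonneg)
    (Kernel.measurable_coe _ hB).ennreal_toReal.aestronglyMeasurable]
  simp

/-- Reversibility is self-adjointness of the Markov operator. -/
theorem isSelfAdjoint_markovOp (hr : P.IsReversible μ) (h : P.Invariant μ) :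
    IsSelfAdjoint (markovOp P μ h) := by
  set L := markovOp P μ h
  -- `L† - L` vanishes on indicators, because it maps them to vectors orthogonal to all indicators
  set D : Lp ℂ 2 μ →L[ℂ] Lp ℂ 2 μ := ContinuousLinearMap.adjoint L - L with hD
  have h1 : ∀ (B : Set X) (hB : MeasurableSet B), D (indL2 μ hB) = 0 := by
    intro B hB
    have htop : (innerSL ℂ (D (indL2 μ hB))).ker = ⊤ := by
      refine eq_top_of_indL2_mem _ (innerSL ℂ (D (indL2 μ hB))).isClosed_ker fun A hA => ?_
      rw [LinearMap.mem_ker]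
      change inner ℂ (D (indL2 μ hB)) (indL2 μ hA) = 0
      rw [hD, sub_apply, inner_sub_left,
        ContinuousLinearMap.adjoint_inner_left, inner_indL2_markovOp_indL2 h hB hA,
        ← inner_conj_symm, inner_indL2_markovOp_indL2 h hA hB, Complex.conj_ofReal, hr hA hB,
        sub_self]
    have : D (indL2 μ hB) ∈ (innerSL ℂ (D (indL2 μ hB))).ker := htop ▸ Submodule.mem_top
    exact inner_self_eq_zero.1 this
  have htop : D.ker = ⊤ := eq_top_of_indL2_mem _ D.isClosed_ker fun B hB => h1 B hB
  have hD0 : D = 0 := by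
    ext1 f
    exact (htop ▸ Submodule.mem_top : f ∈ D.ker)
  rw [ContinuousLinearMap.isSelfAdjoint_iff']
  exact sub_eq_zero.1 hD0

/-- The orthogonal projection of `L²(μ)` onto the constants. -/
noncomputable def meanProj (μ : Measure X) [IsProbabilityMeasure μ] : Lp ℂ 2 μ →L[ℂ] Lp ℂ 2 μ :=
  (innerSL ℂ (indL2 μ MeasurableSet.univ)).smulRight (indL2 μ MeasurableSet.univ)

theorem meanProj_apply (f : Lp ℂ 2 μ) :
    meanProj μ f = inner ℂ (indL2 μ MeasurableSet.univ) f • indL2 μ MeasurableSet.univ := rfl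

theorem inner_one_one :
    inner ℂ (indL2 μ MeasurableSet.univ) (indL2 μ MeasurableSet.univ) = (1 : ℂ) := by
  rw [L2.inner_indicatorConstLp_indicatorConstLp]
  simp

theorem markovOp_one (h : P.Invariant μ) :
    markovOp P μ h (indL2 μ MeasurableSet.univ) = indL2 μ MeasurableSet.univ := by
  refine Lp.ext ?_
  have h0 := markovOp_pow_indL2_ae h MeasurableSet.univ 0
  have h1 := markovOp_pow_indL2_ae h MeasurableSet.univ 1
  rw [pow_zero, one_apply_eq_self] at h0
  rw [pow_one] at h1
  filter_upwards [h0, h1] with x hx0 hx1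
  have := isMarkovKernel_pow P 0
  have := isMarkovKernel_pow P 1
  rw [hx0, hx1, probReal_univ, probReal_univ]

theorem meanProj_mul_self : meanProj μ * meanProj μ = meanProj μ := by
  ext1 f
  rw [mul_apply_eq_comp, meanProj_apply, meanProj_apply, inner_smul_right, inner_one_one, mul_one]

theorem markovOp_mul_meanProj (h : P.Invariant μ) : markovOp P μ h * meanProj μ = meanProj μ := by
  ext1 f
  rw [mul_apply_eq_comp, meanProj_apply, map_smul, markovOp_one]

theorem meanProj_mul_markovOp (hr : P.IsReversible μ) (h : P.Invariant μ) :
    meanProj μ * markovOp P μ h = meanProj μ := by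
  ext1 f
  rw [mul_apply_eq_comp, meanProj_apply, meanProj_apply]
  congr 1
  have := (isSelfAdjoint_markovOp hr h).isSymmetric (indL2 μ MeasurableSet.univ) f
  change inner ℂ (markovOp P μ h _) f = inner ℂ _ (markovOp P μ h f) at this
  rw [← this, markovOp_one]

theorem meanProj_mul_markovOp_pow (hr : P.IsReversible μ) (h : P.Invariant μ) (n : ℕ) :
    meanProj μ * markovOp P μ h ^ n = meanProj μ := by
  induction n with
  | zero => rw [pow_zero, mul_one]
  | succ n ih => rw [pow_succ, ← mul_assoc, ih, meanProj_mul_markovOp hr]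

theorem isSelfAdjoint_meanProj : IsSelfAdjoint (meanProj μ) := by
  rw [ContinuousLinearMap.isSelfAdjoint_iff_isSymmetric]
  intro f g
  change inner ℂ (meanProj μ f) g = inner ℂ f (meanProj μ g)
  rw [meanProj_apply, meanProj_apply, inner_smul_left, inner_smul_right, inner_conj_symm, mul_comm]

/-- The Markov operator with the constants projected out. -/
noncomputable def centeredOp (P : Kernel X X) [IsMarkovKernel P] (μ : Measure X)
    [IsProbabilityMeasure μ] (h : P.Invariant μ) : Lp ℂ 2 μ →L[ℂ] Lp ℂ 2 μ :=
  markovOp P μ h - meanProj μ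

theorem centeredOp_pow (hr : P.IsReversible μ) (h : P.Invariant μ) {n : ℕ} (hn : 0 < n) :
    centeredOp P μ h ^ n = markovOp P μ h ^ n - meanProj μ := by
  induction n, hn using Nat.le_induction with
  | base => simp [centeredOp]
  | succ n _ ih =>
    rw [pow_succ', ih, centeredOp, sub_mul, mul_sub, mul_sub, ← pow_succ', markovOp_mul_meanProj,
      meanProj_mul_self, meanProj_mul_markovOp_pow hr, sub_self, sub_zero]

/-- The norm of `A ^ n 1_B` is a variance. For `n = 0` this fails, as `A ^ 0` does not remove the
mean. -/
theorem norm_centeredOp_pow_indL2_sq (hr : P.IsReversible μ) (h : P.Invariant μ) {B : Set X}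
    (hB : MeasurableSet B) {n : ℕ} (hn : 0 < n) :
    ‖(centeredOp P μ h ^ n) (indL2 μ hB)‖ ^ 2
      = ∫ x, (((P ^ n) x).real B - μ.real B) ^ 2 ∂μ := by
  have hmean : inner ℂ (indL2 μ MeasurableSet.univ) (indL2 μ hB) = (μ.real B : ℂ) := by
    rw [L2.inner_indicatorConstLp_indicatorConstLp]
    simp
  rw [norm_sq_eq_integral, centeredOp_pow hr h hn, sub_apply, meanProj_apply, hmean]
  have hu := markovOp_pow_indL2_ae h (MeasurableSet.univ (α := X)) 0
  rw [pow_zero, one_apply_eq_self] at hu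
  refine integral_congr_ae ?_
  filter_upwards [Lp.coeFn_sub ((markovOp P μ h ^ n) (indL2 μ hB))
    ((μ.real B : ℂ) • indL2 μ MeasurableSet.univ), Lp.coeFn_smul (μ.real B : ℂ)
    (indL2 μ MeasurableSet.univ), markovOp_pow_indL2_ae h hB n, hu] with x h1 h2 h3 h4
  have := isMarkovKernel_pow P 0
  rw [h1, Pi.sub_apply, h2, Pi.smul_apply, h3, h4, probReal_univ, Complex.ofReal_one, smul_eq_mul,
    mul_one, ← Complex.ofReal_sub, Complex.norm_real, Real.norm_eq_abs, sq_abs]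

/-- Geometric decay of the variance of `P ^ (τ n)` on indicators bounds the relaxation time. -/
theorem relaxationTime_le_of_decay (hr : P.IsReversible μ) (h : P.Invariant μ) {τ : ℕ}
    (hτ : 0 < τ) {α C : ℝ} (hα0 : 0 < α) (hα1 : α < 1)
    (hdecay : ∀ B, MeasurableSet B → ∀ n,
      ∫ x, ((((P ^ τ) ^ n) x).real B - μ.real B) ^ 2 ∂μ ≤ C * α ^ n) :
    relaxationTime P μ h ≤ ENNReal.ofReal (2 / (1 - α) * τ) := by
  set A := centeredOp P μ h with hA
  set L := markovOp P μ h with hL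
  have hAsa : IsSelfAdjoint A := (isSelfAdjoint_markovOp hr h).sub isSelfAdjoint_meanProj
  have hnorm : ‖A ^ τ‖ ≤ √α := by
    refine opNorm_le_sqrt_of_decaySubmodule (hAsa.pow τ) hα0 ?_
    refine eq_top_of_indL2_mem _ (Submodule.isClosed_topologicalClosure _) fun B hB => ?_
    refine Submodule.le_topologicalClosure _ ⟨C, fun n hn => ?_⟩
    rw [← pow_mul, hA, norm_centeredOp_pow_indL2_sq hr h hB (Nat.mul_pos hτ hn), pow_mul]
    exact hdecay B hB n
  have hsqrt1 : √α < 1 := by rw [Real.sqrt_lt' one_pos]; simpa using hα1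
  have hτ' : (0 : ℝ) < τ := by exact_mod_cast hτ
  have hAL : A + meanProj μ = L := sub_add_cancel _ _
  have hAp : A * meanProj μ = 0 := by
    rw [hA, centeredOp, sub_mul, markovOp_mul_meanProj, meanProj_mul_self, sub_self]
  -- the spectrum away from `0` and `1` lies in a disc
  have hspec : ∀ z ∈ spectralSet P μ h, z ≠ 1 → ‖z‖ ≤ 1 - (1 - α) / (2 * τ) := by
    rintro z ⟨hz, hz0⟩ hz1
    rw [← hL, ← hAL] at hz
    have hzA := mem_spectrum_of_mem_spectrum_add_idempotent meanProj_mul_self hAp hz hz0 hz1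
    have hzτ : ‖z ^ τ‖ ≤ √α := by
      refine (spectrum.norm_le_norm_mul_of_mem (spectrum.pow_mem_pow A τ hzA)).trans ?_
      exact (mul_le_of_le_one_right (norm_nonneg _) ContinuousLinearMap.norm_id_le).trans hnorm
    have h2 : ‖z‖ ^ (2 * τ) ≤ α := by
      rw [mul_comm, pow_mul, ← norm_pow]
      calc ‖z ^ τ‖ ^ 2 ≤ √α ^ 2 := by gcongr
        _ = α := Real.sq_sqrt hα0.le
    -- Bernoulli's inequality
    have h3 := one_add_mul_le_pow (a := ‖z‖ - 1) (by linarith [norm_nonneg z]) (2 * τ)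
    rw [add_sub_cancel] at h3
    push_cast at h3
    rw [le_sub_comm, div_le_iff₀ (by positivity)]
    nlinarith
  have hone : indL2 μ MeasurableSet.univ ≠ (0 : Lp ℂ 2 μ) := by
    intro h0
    have := inner_one_one (μ := μ)
    rw [h0, inner_zero_left] at this
    exact zero_ne_one this
  have hmult : Module.finrank ℂ (Module.End.eigenspace L.toLinearMap 1) = 1 := by
    have hmem : indL2 μ MeasurableSet.univ ∈ Module.End.eigenspace L.toLinearMap 1 := by
      rw [Module.End.mem_eigenspace_iff, one_smul]
      exact markovOp_one h
    rw [finrank_eq_one_iff_of_nonzero' ⟨_, hmem⟩ fun h0 => hone (congrArg Subtype.val h0)]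
    rintro ⟨f, hf⟩
    refine ⟨inner ℂ (indL2 μ MeasurableSet.univ) f, Subtype.ext ?_⟩
    change meanProj μ f = f
    rw [Module.End.mem_eigenspace_iff, one_smul] at hf
    have hf' : L f = f := hf
    have hLn : ∀ n : ℕ, (L ^ n) f = f := by
      intro n
      induction n with
      | zero => simp
      | succ n ih => rw [pow_succ, mul_apply_eq_comp, hf', ih]
    set g := f - meanProj μ f with hg
    have hAf : (A ^ τ) f = g := by rw [hA, centeredOp_pow hr h hτ, sub_apply, hLn]
    have hAg : (A ^ τ) g = g := by
      obtain ⟨k, rfl⟩ : ∃ k, τ = k + 1 := ⟨τ - 1, by omega⟩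
      have h0 : (A ^ (k + 1)) (meanProj μ f) = 0 := by
        rw [← mul_apply_eq_comp, pow_succ, mul_assoc, hAp, mul_zero]; rfl
      rw [hg, map_sub, h0, sub_zero, hAf]
    have hle := (A ^ τ).le_opNorm g
    rw [hAg] at hle
    have hg0 : ‖g‖ = 0 := by
      by_contra hne
      have hpos : 0 < ‖g‖ := (norm_nonneg g).lt_of_ne (Ne.symm hne)
      have : ‖g‖ < 1 * ‖g‖ := hle.trans_lt (by gcongr; exact hnorm.trans_lt hsqrt1)
      linarith
    exact (sub_eq_zero.1 (norm_eq_zero.1 hg0)).symm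
  have hgap : (1 - α) / (2 * τ) ≤ spectralGap P μ h := by
    rw [spectralGap, if_pos hmult, le_sub_comm]
    refine Real.sSup_le ?_ ?_
    · rintro r ⟨z, hz, hz1, rfl⟩
      exact hspec z hz hz1
    · rw [sub_nonneg, div_le_one (by positivity)]
      have : (1 : ℝ) ≤ τ := by exact_mod_cast hτ
      linarith
  have hpos : 0 < (1 - α) / (2 * τ) := div_pos (by linarith) (by positivity)
  rw [relaxationTime, ← ENNReal.ofReal_inv_of_pos (hpos.trans_le hgap)]
  refine ENNReal.ofReal_le_ofReal ((inv_anti₀ hpos hgap).trans_eq ?_)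
  rw [inv_div]
  ring

end Operator

/-! ### Relaxation time from a confined chain -/

section Comparison

variable {X : Type*} [MeasurableSpace X] {P P' : Kernel X X} {μ ν : Measure X} {G Θ : Set X}

/-- The main estimate for general reversible kernels. The weight `W` is normalized so that
the drift condition has constant `(1 - γ) / 4` and the minorization holds on `{W ≤ 1}`. All
hypotheses are on an absorbing set `G` of full measure, and `P'` is the chain confined to `Θ`. -/
theorem relaxationTime_le_of_comparison [IsMarkovKernel P] [IsMarkovKernel P']
    [IsProbabilityMeasure μ] [IsProbabilityMeasure ν] (hr : P.IsReversible μ) (h : P.Invariant μ)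
    (hGm : MeasurableSet G) (hμG : ∀ᵐ x ∂μ, x ∈ G) (hG : ∀ x ∈ G, ∀ᵐ y ∂(P x), y ∈ G)
    {W : X → ℝ≥0} (hW : Measurable W) {γ : ℝ≥0} (hγ0 : 0 < γ) (hγ : γ < 1)
    (hd : ∀ x ∈ G, ∫⁻ y, W y ∂(P x) ≤ γ * W x + (1 - γ) * (1 / 4 : ℝ≥0))
    (hΘ : MeasurableSet Θ) {τ : ℕ} (hτ : 0 < τ)
    (hWΘ : ∀ x ∈ G, (W x : ℝ) ≤ 8 / (1 - γ) * (1 + (1 - γ) * τ / 4) → x ∈ Θ)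
    (hc : ∀ x ∈ G, x ∈ Θ → P' x ≤ (P x).restrict Θ + P x Θᶜ • Measure.dirac x)
    (hmix : ∀ x ∈ Θ, ∀ A, MeasurableSet A → |((P' ^ τ) x).real A - ν.real A| ≤ 1 / 4) :
    relaxationTime P μ h ≤ ENNReal.ofReal (20 / (1 - γ) * τ) := by
  have hγ1 : (0 : ℝ) < 1 - γ := sub_pos.2 (by exact_mod_cast hγ)
  have hγ0' : (0 : ℝ) < γ := by exact_mod_cast hγ0
  set R : ℝ≥0 := 8 / (1 - γ) * (1 + (1 - γ) * τ / 4) with hR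
  have hRcoe : (R : ℝ) = 8 / (1 - γ) * (1 + (1 - γ) * τ / 4) := by
    rw [hR]; push_cast [NNReal.coe_sub hγ.le]; ring
  have hR1 : (1 : ℝ) ≤ R := by
    rw [hRcoe, div_mul_eq_mul_div, le_div_iff₀ hγ1]
    have : 0 ≤ (1 - (γ : ℝ)) * τ / 4 := by positivity
    linarith
  have hRpos : 0 < R := by exact_mod_cast one_pos.trans_le hR1
  have := isMarkovKernel_pow P τ
  have := isMarkovKernel_pow P' τ
  -- off `Θ` the rescaled weight is at least `1`
  have hcomp : ∀ x ∈ G, W x ≤ 1 → ∀ A, MeasurableSet A →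
      ((P' ^ τ) x).real A ≤ ((P ^ τ) x).real A + 1 / 8 := by
    intro x hx hWx A hA
    have hle := pow_apply_le_of_comparison (P := P) (P' := P') (U := fun x => R⁻¹ * W x)
      (k := R⁻¹ * ((1 - γ) * (1 / 4))) (hW.const_mul _) hΘ hG ?_ ?_ hc hA τ x hx
    · have hfin : (P' ^ τ) x A ≤ (P ^ τ) x A
          + ((R⁻¹ * W x + τ * (R⁻¹ * ((1 - γ) * (1 / 4))) : ℝ≥0) : ℝ≥0∞) := by
        refine hle.trans_eq ?_
        push_cast
        ring
      have hre := ENNReal.toReal_mono (by finiteness) hfin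
      rw [ENNReal.toReal_add (by finiteness) (by finiteness), ENNReal.coe_toReal] at hre
      push_cast [NNReal.coe_sub hγ.le] at hre
      refine hre.trans (add_le_add_right ?_ _)
      have hWx' : (W x : ℝ) ≤ 1 := by exact_mod_cast hWx
      have e : (R : ℝ)⁻¹ * W x + τ * ((R : ℝ)⁻¹ * ((1 - γ) * (1 / 4)))
          = (W x + (1 - γ) * τ / 4) / R := by
        field_simp
      rw [e, div_le_iff₀ (by positivity), hRcoe]
      have e2 : 1 / 8 * (8 / (1 - (γ : ℝ)) * (1 + (1 - γ) * τ / 4))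
          = (1 + (1 - γ) * τ / 4) / (1 - γ) := by field_simp
      rw [e2, le_div_iff₀ hγ1]
      have h0 : 0 ≤ (W x : ℝ) + (1 - γ) * τ / 4 := by positivity
      have h1 : (W x + (1 - (γ : ℝ)) * τ / 4) * (1 - γ) ≤ W x + (1 - γ) * τ / 4 :=
        mul_le_of_le_one_right h0 (by linarith)
      linarith
    · intro y hy
      calc ∫⁻ z, ((R⁻¹ * W z : ℝ≥0) : ℝ≥0∞) ∂(P y) = (R⁻¹ : ℝ≥0) * ∫⁻ z, W z ∂(P y) := by
            simp_rw [ENNReal.coe_mul]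
            rw [lintegral_const_mul _ hW.coe_nnreal_ennreal]
        _ ≤ (R⁻¹ : ℝ≥0) * (W y + (1 - γ) * (1 / 4 : ℝ≥0)) := by
            refine mul_le_mul_right ((hd y hy).trans ?_) _
            gcongr
            exact mul_le_of_le_one_left bot_le (by exact_mod_cast hγ.le)
        _ = _ := by push_cast; ring
    · intro y hy hyΘ
      have hlt : ¬ (W y : ℝ) ≤ R := fun hle => hyΘ (hWΘ y hy (hRcoe ▸ hle))
      have hlt' : R ≤ W y := (NNReal.coe_lt_coe.1 (not_le.1 hlt)).le
      calc (1 : ℝ≥0) = R⁻¹ * R := (inv_mul_cancel₀ hRpos.ne').symm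
        _ ≤ R⁻¹ * W y := by gcongr
  have hloc : ∀ x ∈ G, ∀ y ∈ G, W x ≤ 1 → W y ≤ 1 → ∀ A, MeasurableSet A →
      ((P ^ τ) x).real A ≤ ((P ^ τ) y).real A + 3 / 4 := by
    intro x hx y hy hWx hWy A hA
    have hmem : ∀ x ∈ G, W x ≤ 1 → x ∈ Θ := fun x hx hWx =>
      hWΘ x hx (hRcoe ▸ le_trans (by exact_mod_cast hWx) hR1)
    -- the one-sided comparison for the complement of `A` gives the other side
    have h1 := hcomp x hx hWx Aᶜ hA.compl
    rw [probReal_compl_eq_one_sub hA, probReal_compl_eq_one_sub hA] at h1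
    have h2 := hcomp y hy hWy A hA
    have h3 := le_of_abs_le (hmix x (hmem x hx hWx) A hA)
    have h4 := neg_le_of_abs_le (hmix y (hmem y hy hWy) A hA)
    linarith
  have hdτ : ∀ x ∈ G, ∫⁻ y, W y ∂((P ^ τ) x)
      ≤ (γ ^ τ : ℝ≥0) * W x + (1 - (γ ^ τ : ℝ≥0)) * (1 / 4 : ℝ≥0) := by
    intro x hx
    rw [ENNReal.coe_pow]
    exact lintegral_pow_le_of_drift hW hγ hG hd τ x hx
  refine (relaxationTime_le_of_decay hr h hτ (α := (9 + γ) / 10) (C := 3) (by positivity)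
    (by linarith) fun B hB n => integral_sq_real_pow_sub_le_of_drift (invariant_pow h τ) hμG hW
      (ae_mem_pow hGm hG τ) (pow_le_of_le_one bot_le hγ.le hτ.ne') hγ hdτ hloc hB n).trans_eq ?_
  congr 2
  rw [show 1 - (9 + (γ : ℝ)) / 10 = (1 - γ) / 10 by ring]
  field_simp
  norm_num

end Comparison

/-! ### Metropolis-Hastings kernels with a restricted target -/

section Metropolis

variable {E : Type*} [MeasureSpace E]

theorem ae_density_ne_zero (p : ProbDensity E) : ∀ᵐ x ∂p.measure, p.toFun x ≠ 0 := by
  rw [ProbDensity.measure, ae_withDensity_iff p.measurable.coe_nnreal_ennreal]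
  exact .of_forall fun x hx => by exact_mod_cast hx

theorem moveDensity_eq_zero {p : ProbDensity E} (q : ProposalDensity E) {x y : E}
    (hx : p.toFun x ≠ 0) (hy : p.toFun y = 0) : moveDensity p q x y = 0 := by
  have := density_mul_moveDensity_symm p q x y
  rw [hy, ENNReal.coe_zero, zero_mul] at this
  exact (mul_eq_zero.1 this).resolve_left (by exact_mod_cast hx)

/-- Restricting the target to `Θ` suppresses exactly the moves that leave `Θ`. -/
theorem moveDensity_restrict (p : ProbDensity E) (q : ProposalDensity E) {Θ : Set E}
    (hΘ : MeasurableSet Θ) (hpos : p.measure Θ ≠ 0) {x : E} (hxΘ : x ∈ Θ) (hx : p.toFun x ≠ 0) :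
    moveDensity (p.restrict Θ hΘ hpos) q x = Θ.indicator (moveDensity p q x) := by
  have hc : (p.measure Θ).toNNReal ≠ 0 := (ENNReal.toNNReal_pos hpos (measure_ne_top _ _)).ne'
  have hin : ∀ z ∈ Θ, (p.restrict Θ hΘ hpos).toFun z = p.toFun z / (p.measure Θ).toNNReal :=
    fun z hz => by simp [ProbDensity.restrict, hz]
  funext y
  by_cases hy : y ∈ Θ
  · rw [Set.indicator_of_mem hy, moveDensity, moveDensity]
    congr 2
    rw [acceptance, acceptance, hin x hxΘ, hin y hy]
    by_cases hq : q.toFun x y = 0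
    · simp [hq]
    · rw [if_neg (mul_ne_zero (div_ne_zero hx hc) hq), if_neg (mul_ne_zero hx hq)]
      congr 1
      field_simp
  · rw [Set.indicator_of_notMem hy]
    refine moveDensity_eq_zero q ?_
      (by simp [ProbDensity.restrict, hy])
    rw [hin x hxΘ]
    exact div_ne_zero hx hc

variable [SFinite (volume : Measure E)]

theorem ae_metropolis_density_ne_zero (p : ProbDensity E) (q : ProposalDensity E) {x : E}
    (hx : p.toFun x ≠ 0) : ∀ᵐ y ∂(metropolis p q x), p.toFun y ≠ 0 := by
  have hs : MeasurableSet {y | p.toFun y = 0} := p.measurable (measurableSet_singleton 0)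
  have hset : {y | ¬ p.toFun y ≠ 0} = {y | p.toFun y = 0} := by ext; simp
  rw [ae_iff, hset, metropolis_apply p q x hs, setLIntegral_congr_fun (g := fun _ => 0) hs
    fun y hy => moveDensity_eq_zero q hx hy]
  simp [hx]

theorem metropolis_restrict_le (p : ProbDensity E) (q : ProposalDensity E) {Θ : Set E}
    (hΘ : MeasurableSet Θ) (hpos : p.measure Θ ≠ 0) {x : E} (hxΘ : x ∈ Θ) (hx : p.toFun x ≠ 0) :
    metropolis (p.restrict Θ hΘ hpos) q x
      ≤ (metropolis p q x).restrict Θ + metropolis p q x Θᶜ • Measure.dirac x := by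
  refine Measure.le_iff.2 fun s hs => ?_
  rw [metropolis_apply _ q x hs, moveDensity_restrict p q hΘ hpos hxΘ hx,
    lintegral_indicator hΘ, lintegral_indicator hΘ, Measure.restrict_restrict hΘ,
    Measure.add_apply, Measure.restrict_apply hs, Measure.smul_apply, smul_eq_mul,
    Measure.dirac_apply' _ hs, metropolis_apply p q x (hs.inter hΘ),
    metropolis_apply p q x hΘ.compl, Set.inter_comm Θ s, add_assoc]
  refine add_le_add_right ?_ _
  by_cases hxs : x ∈ s
  · rw [← lintegral_add_compl (μ := volume) (moveDensity p q x) hΘ]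
    simp only [Set.indicator_of_mem hxs, Set.indicator_of_mem (Set.mem_inter hxs hxΘ),
      Pi.one_apply, mul_one, Set.indicator_of_notMem (Set.notMem_compl_iff.2 hxΘ), mul_zero,
      add_zero]
    refine tsub_le_iff_left.2 ?_
    rw [add_comm (1 - _), ← add_assoc]
    exact le_add_tsub (α := ℝ≥0∞)
  · simp [hxs]

end Metropolis

/-! ### The mixing time -/

section Mixing

variable {X : Type*} [MeasurableSpace X]

/-- A finite mixing time is attained. -/
theorem iSup_tvDist_lt_of_mixingTime_eq {P : Kernel X X} {μ : Measure X} {Θ : Set X} {τ : ℕ}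
    (h : mixingTime P μ Θ = τ) : ⨆ x ∈ Θ, tvDist ((P ^ τ) x) μ < 1 / 4 := by
  have hlt : mixingTime P μ Θ < (τ + 1 : ℕ) := by rw [h]; exact_mod_cast τ.lt_succ_self
  simp only [mixingTime, iInf_lt_iff] at hlt
  obtain ⟨t, ht, htτ⟩ := hlt
  have hle : mixingTime P μ Θ ≤ t := iInf₂_le t ht
  rw [h] at hle
  have h1 : τ ≤ t := by exact_mod_cast hle
  have h2 : t < τ + 1 := by exact_mod_cast htτ
  obtain rfl : t = τ := by omega
  exact ht

theorem abs_sub_le_of_iSup_tvDist_lt {P : Kernel X X} {μ : Measure X} {Θ : Set X} {t : ℕ}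
    (h : ⨆ x ∈ Θ, tvDist ((P ^ t) x) μ < 1 / 4) {x : X} (hx : x ∈ Θ) {A : Set X}
    (hA : MeasurableSet A) : |((P ^ t) x).real A - μ.real A| < 1 / 4 := by
  have h1 : ENNReal.ofReal |((P ^ t) x).real A - μ.real A| < 1 / 4 :=
    ((le_iSup₂_of_le (f := fun A _ => ENNReal.ofReal |((P ^ t) x).real A - μ.real A|) A hA
      le_rfl).trans (le_iSup₂_of_le (f := fun x _ => tvDist ((P ^ t) x) μ) x hx le_rfl)).trans_lt h
  have h2 : (1 / 4 : ℝ≥0∞) = ENNReal.ofReal (1 / 4) := by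
    rw [ENNReal.ofReal_div_of_pos (by norm_num)]; simp
  rw [h2, ENNReal.ofReal_lt_ofReal_iff (by norm_num)] at h1
  exact h1

/-- The chain does not mix at time `0`, since the target has no atoms. -/
theorem mixingTime_pos {P : Kernel X X} [MeasurableSingletonClass X] {μ : Measure X}
    [NullSingletonClass μ] {Θ : Set X} (hne : Θ.Nonempty) {τ : ℕ} (h : mixingTime P μ Θ = τ) : 0 < τ := by
  refine Nat.pos_of_ne_zero ?_
  rintro rfl
  obtain ⟨x, hx⟩ := hne
  have h1 := abs_sub_le_of_iSup_tvDist_lt (iSup_tvDist_lt_of_mixingTime_eq h) hx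
    (measurableSet_singleton x)
  rw [pow_zero] at h1
  change |((Kernel.id : Kernel X X) x).real {x} - _| < _ at h1
  rw [Kernel.id_apply] at h1
  simp [Measure.real] at h1
  norm_num at h1

end Mixing

end MHGap

open MHGap

theorem lemma1 (γ K : ℝ) (hγ0 : 0 < γ) (hγ1 : γ < 1) (hK : 0 ≤ K) :
    ∃ C : ℝ≥0, ∀ (d : ℕ), 0 < d →
      ∀ (p : MHGap.ProbDensity (EuclideanSpace ℝ (Fin d)))
        (q : MHGap.ProposalDensity (EuclideanSpace ℝ (Fin d)))
        (V : EuclideanSpace ℝ (Fin d) → ℝ≥0), Measurable V →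
        (∀ x, ∫⁻ y, (V y : ℝ≥0∞) ∂(MHGap.metropolis p q x) ≤ ENNReal.ofReal (γ * V x + K)) →
        ∀ (Θ : Set (EuclideanSpace ℝ (Fin d))) (hΘ : MeasurableSet Θ)
          (hpos : p.measure Θ ≠ 0) (τ : ℕ),
          MHGap.mixingTime (MHGap.metropolis (p.restrict Θ hΘ hpos) q) (p.measure[|Θ]) Θ = τ →
          {x | (V x : ℝ) ≤ 8 / (1 - γ) * (4 * K / (1 - γ) + K * τ)} ⊆ Θ →
          MHGap.relaxationTime (MHGap.metropolis p q) p.measure (MHGap.metropolis_invariant p q)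
            ≤ C * τ := by
  lift γ to ℝ≥0 using hγ0.le
  lift K to ℝ≥0 using hK
  have hγ0' : 0 < γ := by exact_mod_cast hγ0
  have hγ1' : γ < 1 := by exact_mod_cast hγ1
  have h1γ : (0 : ℝ) < 1 - γ := sub_pos.2 hγ1
  have h1γ' : 0 < 1 - γ := tsub_pos_of_lt hγ1'
  refine ⟨20 / (1 - γ), fun d hd p q V hV hdrift Θ hΘ hpos τ hτ hVΘ => ?_⟩
  have : Nonempty (Fin d) := ⟨⟨0, hd⟩⟩
  have : IsProbabilityMeasure (p.measure[|Θ]) := cond_isProbabilityMeasure hpos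
  have : NullSingletonClass p.measure := by
    rw [ProbDensity.measure]; infer_instance
  have : NullSingletonClass (p.measure[|Θ]) :=
    ⟨fun x => cond_absolutelyContinuous (measure_singleton x)⟩
  have hτ0 : 0 < τ := mixingTime_pos (nonempty_of_measure_ne_zero hpos) hτ
  have hmix := fun x (hx : x ∈ Θ) A (hA : MeasurableSet A) =>
    (abs_sub_le_of_iSup_tvDist_lt (iSup_tvDist_lt_of_mixingTime_eq hτ) hx hA).le
  have hC : ENNReal.ofReal (20 / (1 - γ) * τ) = ((20 / (1 - γ) : ℝ≥0) : ℝ≥0∞) * τ := by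
    rw [ENNReal.ofReal_mul (by positivity), ENNReal.ofReal_natCast,
      ← ENNReal.ofReal_coe_nnreal (p := 20 / (1 - γ))]
    push_cast [NNReal.coe_sub hγ1'.le]
    rfl
  have hdrift' : ∀ x, ∫⁻ y, (V y : ℝ≥0∞) ∂(metropolis p q x) ≤ ((γ * V x + K : ℝ≥0) : ℝ≥0∞) := by
    intro x
    refine (hdrift x).trans_eq ?_
    rw [← ENNReal.ofReal_coe_nnreal]
    push_cast
    rfl
  have hGm : MeasurableSet {x | p.toFun x ≠ 0} :=
    (p.measurable (measurableSet_singleton 0)).compl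
  rw [← hC]
  rcases eq_or_ne K 0 with rfl | hK0
  · -- For `K = 0` the drift condition forces `V = 0` almost everywhere, and `W = 0` will do.
    have hV0 : ∀ᵐ x ∂p.measure, V x = 0 := by
      have hint : ∫⁻ x, V x ∂p.measure ≤ (0 : ℝ≥0) :=
        lintegral_le_of_drift (P := metropolis p q) (G := Set.univ) hV hγ1' (by simp)
          (metropolis_invariant p q) (by simp) fun x _ => by simpa using hdrift' x
      have h0 := (lintegral_eq_zero_iff hV.coe_nnreal_ennreal).1 (le_antisymm (by simpa using hint)
        bot_le)
      filter_upwards [h0] with x hx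
      simpa using hx
    refine relaxationTime_le_of_comparison (G := {x | p.toFun x ≠ 0} ∩ {x | V x = 0})
      (W := fun _ => 0) (metropolis_reversible p q) (metropolis_invariant p q)
      (hGm.inter (hV (measurableSet_singleton 0))) ?_ ?_ measurable_const hγ0' hγ1' ?_ hΘ hτ0 ?_
      (fun x hx hxΘ => metropolis_restrict_le p q hΘ hpos hxΘ hx.1) hmix
    · filter_upwards [ae_density_ne_zero p, hV0] with x h1 h2 using ⟨h1, h2⟩
    · rintro x ⟨hx1, hx2⟩
      have hx2' : V x = 0 := hx2
      have h0 := hdrift' x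
      rw [hx2', mul_zero, add_zero, ENNReal.coe_zero] at h0
      have h0' := (lintegral_eq_zero_iff hV.coe_nnreal_ennreal).1 (le_antisymm h0 bot_le)
      filter_upwards [ae_metropolis_density_ne_zero p q hx1, h0'] with y h1 h2
      exact ⟨h1, by simpa using h2⟩
    · intro x _
      simp
    · rintro x ⟨-, hx2⟩ -
      have hx2' : V x = 0 := hx2
      refine hVΘ ?_
      simp [hx2']
  · have hKpos : (0 : ℝ) < K := by
      have := pos_iff_ne_zero.2 hK0
      exact_mod_cast this
    set c : ℝ≥0 := (1 - γ) / (4 * K) with hc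
    have hccoe : (c : ℝ) = (1 - γ) / (4 * K) := by
      rw [hc]; push_cast [NNReal.coe_sub hγ1'.le]; rfl
    refine relaxationTime_le_of_comparison (G := {x | p.toFun x ≠ 0})
      (W := fun x => c * V x) (metropolis_reversible p q) (metropolis_invariant p q)
      hGm (ae_density_ne_zero p) (fun x hx => ae_metropolis_density_ne_zero p q hx)
      (hV.const_mul _) hγ0' hγ1' ?_ hΘ hτ0 ?_
      (fun x hx hxΘ => metropolis_restrict_le p q hΘ hpos hxΘ hx) hmix
    · intro x _
      have e : c * (γ * V x + K) = γ * (c * V x) + (1 - γ) * (1 / 4) := by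
        have : c * K = (1 - γ) * (1 / 4) := by rw [hc]; field_simp
        rw [mul_add, this]; ring
      calc ∫⁻ y, ((c * V y : ℝ≥0) : ℝ≥0∞) ∂(metropolis p q x)
          = c * ∫⁻ y, V y ∂(metropolis p q x) := by
            simp_rw [ENNReal.coe_mul]
            rw [lintegral_const_mul _ hV.coe_nnreal_ennreal]
        _ ≤ c * ((γ * V x + K : ℝ≥0) : ℝ≥0∞) := mul_le_mul_right (hdrift' x) _
        _ = _ := by rw [← ENNReal.coe_mul, e]; push_cast; rfl
    · intro x _ hx
      refine hVΘ ?_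
      rw [NNReal.coe_mul, hccoe] at hx
      have hx' : (V x : ℝ) ≤ (8 / (1 - γ) * (1 + (1 - γ) * τ / 4)) * ((4 * K) / (1 - γ)) := by
        rw [← div_le_iff₀ (by positivity)]
        refine le_trans (le_of_eq ?_) hx
        field_simp
      refine hx'.trans_eq ?_
      field_simp
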